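/- Let $n \ge 0$, and let $\mathcal{T}_n$ be the arrangement of hyperplanes $\{x_i + x_j = 0\}$, $1 \le i < j \le n$, in $\mathbb{R}^n$. Its characteristic polynomial is $\chi_{\mathcal{T}_n}(t) = \sum_{X \in L(\mathcal{T}_n)} \mu(\hat 0, X)\, t^{\dim X}$, where $L(\mathcal{T}_n)$ is the poset of non-empty intersections of hyperplanes of $\mathcal{T}_n$ ordered by reverse inclusion, with least element $\hat 0 = \mathbb{R}^n$ (the empty intersection), and $\mu$ is its Möbius function. A labeled threshold graph on $[n] = \{1,\dots,n\}$ is a graph that is obtained from the empty graph by adding the vertices $1,\dots,n$ one at a time in some order, each either as a dominant vertex (adjacent to all vertices added before it) or as a recessive vertex (adjacent to none of the vertices added before it). The order together with the choice of a type, dominant or recessive, for every vertex (including the first one added) is a construction of the graph. A construction follows the convention about the vertex $1$ if either $1$ is the first vertex added and its type is dominant, or some vertex added before $1$, other than the first vertex added, has a type different from that of $1$. An anchor of a construction is a vertex whose label is smaller than the labels of all vertices added after it. An anchor is odd if it is the first anchor and is dominant, or if it is not the first anchor and its type is different from that of the previous anchor. Then every labeled threshold graph on $[n]$ has a construction that follows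 the convention, and all its constructions that follow the convention have the same number of odd anchors, called the number of odd anchors of the graph. For every $j \ge 0$, the absolute value of the coefficient of $t^j$ in $\chi_{\mathcal{T}_n}(t)$ equals the number of labeled threshold graphs on $[n]$ with exactly $j$ odd anchors. -/

import Mathlib

/-- The intersection poset of a finite collection `A` of affine hyperplanes (more generally, affine
subspaces) of `ℝⁿ`: its elements are the non-empty intersections of subcollections of `A`, the empty
subcollection giving `ℝⁿ`. -/
@[ext]
structure IntersectionPoset {n : ℕ} (A : Finset (AffineSubspace ℝ (Fin n → ℝ))) where
  flat : AffineSubspace ℝ (Fin n → ℝ)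
  nonempty : (flat : Set (Fin n → ℝ)).Nonempty
  exists_eq : ∃ S ⊆ A, flat = S.inf id

namespace IntersectionPoset

variable {n : ℕ} (A : Finset (AffineSubspace ℝ (Fin n → ℝ)))

/-- The order is reverse inclusion. -/
instance : PartialOrder (IntersectionPoset A) :=
  PartialOrder.lift (fun X => OrderDual.toDual X.flat) fun _ _ h =>
    IntersectionPoset.ext (OrderDual.toDual_inj.mp h)

theorem le_iff (X Y : IntersectionPoset A) : X ≤ Y ↔ Y.flat ≤ X.flat := Iff.rfl

instance : Finite (IntersectionPoset A) := by
  have h : (Set.range fun S : A.powerset => S.1.inf id).Finite := Set.finite_range _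
  have := h.to_subtype
  refine Finite.of_injective
    (fun X : IntersectionPoset A =>
      (⟨X.flat, ?_⟩ : Set.range fun S : A.powerset => S.1.inf id)) ?_
  · obtain ⟨S, hS, hX⟩ := X.exists_eq
    exact ⟨⟨S, Finset.mem_powerset.mpr hS⟩, hX.symm⟩
  · intro X Y hXY
    exact IntersectionPoset.ext (congrArg Subtype.val hXY)

noncomputable instance : Fintype (IntersectionPoset A) := Fintype.ofFinite _

open scoped Classical in
noncomputable instance : LocallyFiniteOrder (IntersectionPoset A) :=
  Fintype.toLocallyFiniteOrder

/-- The least element `0̂` of the intersection poset, the ambient space `ℝⁿ`. -/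
def ambient : IntersectionPoset A :=
  ⟨⊤, ⟨0, AffineSubspace.mem_top ℝ _ _⟩, ∅, Finset.empty_subset _, rfl⟩

end IntersectionPoset

open scoped Classical in
/-- The characteristic polynomial `∑_{X ∈ L(A)} μ(0̂, X) t ^ dim X` of an arrangement `A`, where `μ`
is the Möbius function of the intersection poset `L(A)`. -/
noncomputable def characteristicPolynomial {n : ℕ}
    (A : Finset (AffineSubspace ℝ (Fin n → ℝ))) : Polynomial ℤ :=
  ∑ X : IntersectionPoset A,
    Polynomial.C (IncidenceAlgebra.mu ℤ (IntersectionPoset.ambient A) X) *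
      Polynomial.X ^ Module.finrank ℝ X.flat.direction

/-- The hyperplane `x_i + x_j = 0` in `ℝⁿ` (for `i ≠ j`). -/
def sumHyperplane {n : ℕ} (i j : Fin n) : AffineSubspace ℝ (Fin n → ℝ) :=
  (LinearMap.ker ((LinearMap.proj i : (Fin n → ℝ) →ₗ[ℝ] ℝ) + LinearMap.proj j)).toAffineSubspace

theorem mem_sumHyperplane {n : ℕ} (i j : Fin n) (x : Fin n → ℝ) :
    x ∈ sumHyperplane i j ↔ x i + x j = 0 := by
  simp [sumHyperplane]

open scoped Classical in
/-- The threshold arrangement `{x_i + x_j = 0 : i < j}` in `ℝⁿ`. -/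
noncomputable def thresholdArrangement (n : ℕ) : Finset (AffineSubspace ℝ (Fin n → ℝ)) :=
  (Finset.univ.filter (fun p : Fin n × Fin n => p.1 < p.2)).image
    (fun p => sumHyperplane p.1 p.2)

/-- A construction of a labeled threshold graph on `n` vertices, that is, a signed permutation:
at step `k` the vertex `vertex k` is added, as a dominant vertex (adjacent to all vertices added
before it) if `dominant k` is `true`, and as a recessive vertex (adjacent to none of them)
otherwise. The label set `{1, …, n}` is represented by `Fin n`, so that the label `1` is the element
of `Fin n` with value `0`. -/
structure ThresholdConstruction (n : ℕ) where
  vertex : Equiv.Perm (Fin n)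
  dominant : Fin n → Bool

namespace ThresholdConstruction

variable {n : ℕ} (c : ThresholdConstruction n)

/-- The graph obtained from a construction: two distinct vertices are adjacent exactly when the one
that was added later is dominant. -/
def graph : SimpleGraph (Fin n) :=
  SimpleGraph.fromRel fun u v =>
    c.vertex.symm u < c.vertex.symm v ∧ c.dominant (c.vertex.symm v) = true

/-- The convention about vertex `1`: it is either the first vertex added, and then it counts as
dominant, or before it some vertex other than the first one was added that is of a different type
than vertex `1`. -/
def FollowsConvention : Prop :=
  ∀ p : Fin n, (c.vertex p).val = 0 →
    (p.val = 0 ∧ c.dominant p = true) ∨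
      ∃ i : Fin n, 0 < i.val ∧ i < p ∧ c.dominant i ≠ c.dominant p

/-- The vertex added at step `k` is an anchor if its label is smaller than the label of every vertex
added after it. -/
def IsAnchor (k : Fin n) : Prop :=
  ∀ l : Fin n, k < l → c.vertex k < c.vertex l

/-- `k` and `l` are the steps of two consecutive anchors, `k` coming before `l`. -/
def IsPreviousAnchor (k l : Fin n) : Prop :=
  c.IsAnchor k ∧ c.IsAnchor l ∧ k < l ∧ ∀ m : Fin n, k < m → m < l → ¬ c.IsAnchor m

/-- An odd anchor is an anchor that is the first anchor and dominant, or that is of a different type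
than the previous anchor. -/
def IsOddAnchor (k : Fin n) : Prop :=
  c.IsAnchor k ∧
    (((∀ l : Fin n, l < k → ¬ c.IsAnchor l) ∧ c.dominant k = true) ∨
      ∃ l : Fin n, c.IsPreviousAnchor l k ∧ c.dominant l ≠ c.dominant k)

/-- The number of odd anchors of a construction. -/
noncomputable def numOddAnchors : ℕ :=
  {k : Fin n | c.IsOddAnchor k}.ncard

end ThresholdConstruction

/-- A labeled threshold graph on `n` vertices is a graph that has a construction. -/
def IsLabeledThresholdGraph {n : ℕ} (G : SimpleGraph (Fin n)) : Prop :=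
  ∃ c : ThresholdConstruction n, c.graph = G

/-- `G` is a labeled threshold graph with exactly `j` odd anchors: some construction of `G` follows
the convention about vertex `1`, and all of those that do have exactly `j` odd anchors. -/
def HasNumOddAnchors {n : ℕ} (G : SimpleGraph (Fin n)) (j : ℕ) : Prop :=
  (∃ c : ThresholdConstruction n, c.graph = G ∧ c.FollowsConvention) ∧
    ∀ c : ThresholdConstruction n, c.graph = G → c.FollowsConvention → c.numOddAnchors = j

/-! Both sides are computed by generating functions and compared at infinitely many points. Every
flat of the arrangement has some free coordinates, and each other coordinate is zero or plus or
minus a free one. It therefore meets the cube `{-m, …, m}^n` in `(2m+1)^dim` points, and Möbius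
inversion shows that `χ(2m+1)` is the number of cube points without zero pairwise sums. Peeling off
the coordinates of absolute value `m`, which must share one sign, gives this count the exponential
generating function `(1 + x)(2e^x - 1)^m` (`egf_numThresholdColorings`). On the graph side,
constructions are words of labels with types. Reordering a run of equal types changes neither the
graph nor the number of odd anchors, so runs may be sorted. A sorted word splits uniquely at its
least label, the last anchor of any prefix ending there, as `u (a, σ) v` with `u` not ending in type
`σ`. If `R` is the generating function of the possible `u` and `A` that of all sorted words weighted
by `t ^ oddAnchorCount`, then `R' = R(2R - 1)` and `A' = (1 + t) R A`. Hence `R = 1/(2 - e^x)`, and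
for `t = -(2m+1)` one gets `A = (2e^{-x} - 1)^m`. The first type of a word is not visible in the
graph. Normalizing the beginning leaves exactly one canonical word per graph
(`IsCanonical.eq_of_graph_eq`). The discarded words are those obtained by prefixing one weightless
letter to a sorted word on the other labels, so canonical words have generating function `(1 - x)
A`. Replacing `x` by `-x` gives the point count, whence `χ(t) = (-1)^n ∑ (-t)^d` over the graphs,
with `d` the number of odd anchors. Finally, a construction that follows the convention has the same
number of odd anchors as the canonical word of its graph, so the statistic is well defined. -/

/-! ### The characteristic polynomial as a count of lattice points in a cube. -/

section FinitePointCount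

open scoped Classical in
/-- If every flat `X` contains exactly `t ^ dim X` points of the finite set `D`, then `χ(t)` is the
number of points of `D` outside all the hyperplanes. -/
theorem eval_characteristicPolynomial_eq_card {n : ℕ} (A : Finset (AffineSubspace ℝ (Fin n → ℝ)))
    (hA : ⊤ ∉ A) (t : ℤ) (D : Finset (Fin n → ℝ))
    (hD : ∀ X : IntersectionPoset A,
      ((D.filter (fun x => x ∈ X.flat)).card : ℤ) = t ^ Module.finrank ℝ X.flat.direction) :
    (characteristicPolynomial A).eval t = (D.filter (fun x => ∀ H ∈ A, x ∉ H)).card := by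
  have mem_inf : ∀ (S : Finset (AffineSubspace ℝ (Fin n → ℝ))) (x : Fin n → ℝ),
      x ∈ S.inf id ↔ ∀ H ∈ S, x ∈ H := by
    intro S x
    induction S using Finset.induction_on with
    | empty => simp
    | insert H S _ ih => simp [AffineSubspace.mem_inf_iff, ih]
  have key : ∀ x ∈ D, (∑ X : IntersectionPoset A, if x ∈ X.flat then
      IncidenceAlgebra.mu ℤ (IntersectionPoset.ambient A) X else 0) =
      if ∀ H ∈ A, x ∉ H then 1 else 0 := by
    intro x _
    -- `Z` is the smallest flat through `x`. The flats containing `x` form the interval from `0̂` to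
    -- `Z`, over which `μ` sums to zero unless `Z = 0̂`.
    let Z : IntersectionPoset A := ⟨(A.filter (fun H => x ∈ H)).inf id,
      ⟨x, (mem_inf _ x).2 fun H hH => (Finset.mem_filter.1 hH).2⟩, _, Finset.filter_subset _ _, rfl⟩
    have hZ : ∀ X : IntersectionPoset A, x ∈ X.flat ↔ X ≤ Z := by
      intro X
      rw [IntersectionPoset.le_iff]
      constructor
      · intro hx
        obtain ⟨S, hS, hX⟩ := X.exists_eq
        rw [hX, mem_inf] at hx
        rw [hX]
        exact Finset.inf_mono fun H hH => Finset.mem_filter.2 ⟨hS hH, hx H hH⟩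
      · intro h
        exact h ((mem_inf _ x).2 fun H hH => (Finset.mem_filter.1 hH).2)
    have hbot : ∀ X : IntersectionPoset A, IntersectionPoset.ambient A ≤ X := by
      intro X
      rw [IntersectionPoset.le_iff]
      exact le_top
    rw [← Finset.sum_filter]
    have : (Finset.univ.filter fun X : IntersectionPoset A => x ∈ X.flat) =
        Finset.Icc (IntersectionPoset.ambient A) Z := by
      ext X
      simp [hZ, hbot]
    rw [this, IncidenceAlgebra.sum_Icc_mu_right]
    refine if_congr ?_ rfl rfl
    constructor
    · intro h H hH hx
      have h1 : (⊤ : AffineSubspace ℝ (Fin n → ℝ)) = (A.filter (fun H => x ∈ H)).inf id :=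
        congrArg IntersectionPoset.flat h
      have h2 : (A.filter (fun H => x ∈ H)).inf id ≤ H :=
        Finset.inf_le (f := id) (Finset.mem_filter.2 ⟨hH, hx⟩)
      rw [← h1, top_le_iff] at h2
      exact hA (h2 ▸ hH)
    · intro h
      apply IntersectionPoset.ext
      have : A.filter (fun H => x ∈ H) = ∅ := Finset.filter_eq_empty_iff.2 h
      change ⊤ = (A.filter (fun H => x ∈ H)).inf id
      rw [this, Finset.inf_empty]
  rw [characteristicPolynomial, Polynomial.eval_finsetSum]
  simp only [Polynomial.eval_mul, Polynomial.eval_C, Polynomial.eval_pow, Polynomial.eval_X, ← hD]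
  simp only [Finset.card_filter, Nat.cast_sum, Finset.mul_sum]
  rw [Finset.sum_comm]
  refine Finset.sum_congr rfl fun x hx => ?_
  push_cast
  rw [← key x hx]
  refine Finset.sum_congr rfl fun X _ => ?_
  split_ifs <;> simp

/-- A subspace of `ℝ^ι` on which the coordinates from a set `B` are free and every other coordinate
is zero or plus or minus a coordinate from `B`. -/
def IsSignedCoordinateSubspace {ι : Type*} (B : Finset ι) (W : Submodule ℝ (ι → ℝ)) : Prop :=
  (∀ y : ι → ℝ, ∃ x ∈ W, ∀ b ∈ B, x b = y b) ∧
    ∀ i, (∀ x ∈ W, x i = 0) ∨ ∃ b ∈ B, ∃ s : ℝ, (s = 1 ∨ s = -1) ∧ ∀ x ∈ W, x i = s * x b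

namespace IsSignedCoordinateSubspace

variable {ι : Type*} {B : Finset ι} {W : Submodule ℝ (ι → ℝ)}

theorem top [Fintype ι] : IsSignedCoordinateSubspace (Finset.univ : Finset ι) ⊤ :=
  ⟨fun y => ⟨y, trivial, fun _ _ => rfl⟩,
    fun i => Or.inr ⟨i, Finset.mem_univ i, 1, Or.inl rfl, fun _ _ => (one_mul _).symm⟩⟩

theorem eq_of_eqOn (h : IsSignedCoordinateSubspace B W) {x y : ι → ℝ} (hx : x ∈ W) (hy : y ∈ W)
    (hxy : ∀ b ∈ B, x b = y b) : x = y := by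
  ext i
  rcases h.2 i with h0 | ⟨b, hb, s, -, hs⟩
  · rw [h0 x hx, h0 y hy]
  · rw [hs x hx, hs y hy, hxy b hb]

theorem finrank_eq (h : IsSignedCoordinateSubspace B W) : Module.finrank ℝ W = B.card := by
  let f : W →ₗ[ℝ] (B → ℝ) := (LinearMap.funLeft ℝ ℝ (Subtype.val : B → ι)).comp W.subtype
  have hf : Function.Bijective f := by
    constructor
    · intro x y hxy
      apply Subtype.ext
      exact h.eq_of_eqOn x.2 y.2 fun b hb => congrFun hxy ⟨b, hb⟩
    · intro y
      classical
      obtain ⟨x, hx, hxy⟩ := h.1 (fun i => if hi : i ∈ B then y ⟨i, hi⟩ else 0)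
      refine ⟨⟨x, hx⟩, funext fun b => ?_⟩
      change x b = y b
      rw [hxy b b.2]
      simp
  rw [(LinearEquiv.ofBijective f hf).finrank_eq]
  simp

open scoped Classical in
theorem card_filter_piFinset [Fintype ι] (h : IsSignedCoordinateSubspace B W) (I : Finset ℝ)
    (h0 : (0 : ℝ) ∈ I) (hneg : ∀ a ∈ I, -a ∈ I) :
    ((Fintype.piFinset fun _ : ι => I).filter (fun x => x ∈ W)).card = I.card ^ B.card := by
  have : (Fintype.piFinset fun _ : B => I).card = I.card ^ B.card := by simp
  rw [← this]
  refine Finset.card_bij (fun x _ b => x b) ?_ ?_ ?_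
  · intro x hx
    rw [Finset.mem_filter, Fintype.mem_piFinset] at hx
    rw [Fintype.mem_piFinset]
    exact fun b => hx.1 b
  · intro x hx y hy hxy
    rw [Finset.mem_filter] at hx hy
    exact h.eq_of_eqOn hx.2 hy.2 fun b hb => congrFun hxy ⟨b, hb⟩
  · intro y hy
    rw [Fintype.mem_piFinset] at hy
    obtain ⟨x, hx, hxy⟩ := h.1 (fun i => if hi : i ∈ B then y ⟨i, hi⟩ else 0)
    have hB : ∀ b ∈ B, x b ∈ I := by
      intro b hb
      rw [hxy b hb, dif_pos hb]
      exact hy _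
    refine ⟨x, ?_, funext fun b => ?_⟩
    · rw [Finset.mem_filter, Fintype.mem_piFinset]
      refine ⟨fun i => ?_, hx⟩
      rcases h.2 i with hi | ⟨b, hb, s, rfl | rfl, hs⟩
      · rw [hi x hx]; exact h0
      · rw [hs x hx, one_mul]; exact hB b hb
      · rw [hs x hx, neg_one_mul]; exact hneg _ (hB b hb)
    · rw [hxy b b.2]
      simp

theorem inf_eq_mul [DecidableEq ι] (h : IsSignedCoordinateSubspace B W)
    {W' : Submodule ℝ (ι → ℝ)} {b b' : ι} {c : ℝ} (hc : c = 0 ∨ ((c = 1 ∨ c = -1) ∧ b' ∈ B.erase b))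
    (hW' : ∀ x, x ∈ W' ↔ x ∈ W ∧ x b = c * x b') (hb : b ∈ B) :
    IsSignedCoordinateSubspace (B.erase b) W' := by
  constructor
  · intro y
    -- The old free coordinates are prescribed so that the new equation holds automatically.
    obtain ⟨x, hx, hxy⟩ := h.1 (Function.update y b (c * y b'))
    refine ⟨x, (hW' x).2 ⟨hx, ?_⟩, ?_⟩
    · rw [hxy b hb, Function.update_self]
      rcases hc with rfl | ⟨-, hb'⟩
      · simp
      · rw [Finset.mem_erase] at hb'
        rw [hxy b' hb'.2, Function.update_of_ne hb'.1]
    · intro a ha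
      rw [Finset.mem_erase] at ha
      rw [hxy a ha.2, Function.update_of_ne ha.1]
  · intro i
    rcases h.2 i with hi | ⟨a, ha, s, hs, hi⟩
    · exact Or.inl fun x hx => hi x ((hW' x).1 hx).1
    · by_cases hab : a = b
      · subst hab
        rcases hc with rfl | ⟨hc, hb'⟩
        · left
          intro x hx
          rw [hi x ((hW' x).1 hx).1, ((hW' x).1 hx).2]
          simp
        · right
          refine ⟨b', hb', s * c, ?_, fun x hx => ?_⟩
          · rcases hs with rfl | rfl <;> rcases hc with rfl | rfl <;> simp
          · rw [hi x ((hW' x).1 hx).1, ((hW' x).1 hx).2, mul_assoc]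
      · exact Or.inr ⟨a, Finset.mem_erase.2 ⟨hab, ha⟩, s, hs, fun x hx => hi x ((hW' x).1 hx).1⟩

/-- In terms of the free coordinates the new equation is either vacuous, or kills one of them, or
identifies one with plus or minus another; the last two cases remove one free coordinate. -/
theorem exists_inf_add_eq_zero (h : IsSignedCoordinateSubspace B W) {W' : Submodule ℝ (ι → ℝ)}
    {i j : ι} (hW' : ∀ x, x ∈ W' ↔ x ∈ W ∧ x i + x j = 0) :
    ∃ B', IsSignedCoordinateSubspace B' W' := by
  classical
  have same : (∀ x ∈ W, x i + x j = 0) → ∃ B', IsSignedCoordinateSubspace B' W' := by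
    intro h0
    have : W' = W := by
      ext x
      rw [hW']
      exact ⟨fun hx => hx.1, fun hx => ⟨hx, h0 x hx⟩⟩
    exact ⟨B, this ▸ h⟩
  have step : ∀ (b b' : ι) (c : ℝ), (c = 0 ∨ ((c = 1 ∨ c = -1) ∧ b' ∈ B.erase b)) → b ∈ B →
      (∀ x ∈ W, x i + x j = 0 ↔ x b = c * x b') → ∃ B', IsSignedCoordinateSubspace B' W' := by
    intro b b' c hc hb hx
    refine ⟨B.erase b, h.inf_eq_mul hc (fun x => ?_) hb⟩
    rw [hW']
    exact and_congr_right fun hxW => hx x hxW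
  rcases h.2 i with hi | ⟨b, hb, s, hs, hi⟩ <;> rcases h.2 j with hj | ⟨b', hb', s', hs', hj⟩
  · exact same fun x hx => by rw [hi x hx, hj x hx, add_zero]
  · refine step b' b' 0 (Or.inl rfl) hb' fun x hx => ?_
    rw [hi x hx, hj x hx]
    rcases hs' with rfl | rfl <;> simp
  · refine step b b 0 (Or.inl rfl) hb fun x hx => ?_
    rw [hi x hx, hj x hx]
    rcases hs with rfl | rfl <;> simp
  · by_cases hbb : b = b'
    · subst hbb
      by_cases hss : s = s'
      · subst hss
        refine step b b 0 (Or.inl rfl) hb fun x hx => ?_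
        rw [hi x hx, hj x hx]
        rcases hs with rfl | rfl <;> constructor <;> intro h <;> linarith
      · refine same fun x hx => ?_
        rw [hi x hx, hj x hx]
        rcases hs with rfl | rfl <;> rcases hs' with rfl | rfl <;> simp at hss ⊢
    -- Solving `s * x b + s' * x b' = 0` for `x b`, with `s⁻¹ = s` because `s` is a sign.
    · refine step b b' (-(s * s')) (Or.inr ⟨?_, Finset.mem_erase.2 ⟨Ne.symm hbb, hb'⟩⟩) hb
        fun x hx => ?_
      · rcases hs with rfl | rfl <;> rcases hs' with rfl | rfl <;> simp
      · rw [hi x hx, hj x hx]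
        rcases hs with rfl | rfl <;> rcases hs' with rfl | rfl <;> constructor <;> intro h <;>
          linarith

end IsSignedCoordinateSubspace

theorem exists_flat_eq_toAffineSubspace {n : ℕ} (S : Finset (AffineSubspace ℝ (Fin n → ℝ)))
    (hS : S ⊆ thresholdArrangement n) :
    ∃ B W, IsSignedCoordinateSubspace B W ∧ S.inf id = W.toAffineSubspace := by
  classical
  induction S using Finset.induction_on with
  | empty => exact ⟨_, ⊤, IsSignedCoordinateSubspace.top, by ext; simp⟩
  | insert H S _ ih =>
    obtain ⟨B, W, hB, hW⟩ := ih fun K hK => hS (Finset.mem_insert_of_mem hK)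
    have hH := hS (Finset.mem_insert_self H S)
    rw [thresholdArrangement, Finset.mem_image] at hH
    obtain ⟨⟨i, j⟩, -, rfl⟩ := hH
    let K : Submodule ℝ (Fin n → ℝ) :=
      LinearMap.ker ((LinearMap.proj i : (Fin n → ℝ) →ₗ[ℝ] ℝ) + LinearMap.proj j)
    obtain ⟨B', hB'⟩ := hB.exists_inf_add_eq_zero (W' := W ⊓ K) (i := i) (j := j) (fun x => by
      simp [K])
    refine ⟨B', _, hB', ?_⟩
    ext x
    rw [Finset.inf_insert, hW, AffineSubspace.mem_inf_iff]
    simp [mem_sumHyperplane, K, and_comm]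

/-- The points of `{-m, …, m}^V`, extended by zero outside `V`, whose coordinates have no zero
pairwise sums. -/
noncomputable def thresholdColorings {n : ℕ} (V : Finset (Fin n)) (m : ℕ) : Finset (Fin n → ℤ) :=
  (Fintype.piFinset fun i => if i ∈ V then Finset.Icc (-(m : ℤ)) m else {0}).filter
    fun x => ∀ i ∈ V, ∀ j ∈ V, i ≠ j → x i + x j ≠ 0

theorem mem_thresholdColorings {n : ℕ} {V : Finset (Fin n)} {m : ℕ} {x : Fin n → ℤ} :
    x ∈ thresholdColorings V m ↔ (∀ i ∈ V, -(m : ℤ) ≤ x i ∧ x i ≤ m) ∧ (∀ i ∉ V, x i = 0) ∧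
      ∀ i ∈ V, ∀ j ∈ V, i ≠ j → x i + x j ≠ 0 := by
  rw [thresholdColorings, Finset.mem_filter, Fintype.mem_piFinset, ← and_assoc]
  refine and_congr_left fun _ => ?_
  constructor
  · intro h
    refine ⟨fun i hi => ?_, fun i hi => ?_⟩
    · simpa [hi] using h i
    · simpa [hi] using h i
  · rintro ⟨h1, h2⟩ i
    by_cases hi : i ∈ V
    · simpa [hi] using h1 i hi
    · simpa [hi] using h2 i hi

theorem eval_characteristicPolynomial_thresholdArrangement (n m : ℕ) :
    (characteristicPolynomial (thresholdArrangement n)).eval (2 * m + 1 : ℤ) =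
      (thresholdColorings (Finset.univ : Finset (Fin n)) m).card := by
  classical
  let I : Finset ℝ := (Finset.Icc (-(m : ℤ)) m).image (fun a : ℤ => (a : ℝ))
  have hI : (I.card : ℤ) = 2 * m + 1 := by
    rw [Finset.card_image_of_injective _ Int.cast_injective, Int.card_Icc]
    omega
  rw [eval_characteristicPolynomial_eq_card (thresholdArrangement n) ?_ (2 * m + 1)
    (Fintype.piFinset fun _ => I)]
  · congr 1
    symm
    refine Finset.card_bij (fun x _ i => (x i : ℝ)) ?_ ?_ ?_
    · intro x hx
      rw [mem_thresholdColorings] at hx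
      rw [Finset.mem_filter, Fintype.mem_piFinset]
      refine ⟨fun i => Finset.mem_image_of_mem _ (Finset.mem_Icc.2 (hx.1 i (Finset.mem_univ i))), ?_⟩
      intro H hH
      rw [thresholdArrangement, Finset.mem_image] at hH
      obtain ⟨⟨i, j⟩, hij, rfl⟩ := hH
      rw [mem_sumHyperplane]
      have := hx.2.2 i (Finset.mem_univ i) j (Finset.mem_univ j)
        (Finset.mem_filter.1 hij).2.ne
      exact_mod_cast this
    · intro x _ y _ hxy
      ext i
      exact_mod_cast congrFun hxy i
    · intro y hy
      rw [Finset.mem_filter, Fintype.mem_piFinset] at hy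
      have hy1 := hy.1
      simp only [I, Finset.mem_image, Finset.mem_Icc] at hy1
      choose x hx hxy using hy1
      refine ⟨x, ?_, funext hxy⟩
      rw [mem_thresholdColorings]
      refine ⟨fun i _ => hx i, fun i hi => absurd (Finset.mem_univ i) hi, ?_⟩
      have main : ∀ i j : Fin n, i < j → x i + x j ≠ 0 := by
        intro i j hij h0
        have h1 := hy.2 (sumHyperplane i j) (Finset.mem_image.2 ⟨(i, j), by simpa using hij, rfl⟩)
        rw [mem_sumHyperplane, ← hxy, ← hxy] at h1
        exact h1 (by exact_mod_cast h0)
      intro i _ j _ hij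
      rcases lt_or_gt_of_ne hij with h | h
      · exact main i j h
      · rw [add_comm]; exact main j i h
  · intro X
    obtain ⟨S, hS, hX⟩ := X.exists_eq
    obtain ⟨B, W, hB, hW⟩ := exists_flat_eq_toAffineSubspace S hS
    rw [hX, hW, Submodule.toAffineSubspace_direction, hB.finrank_eq, ← hI]
    have hcard := hB.card_filter_piFinset I (Finset.mem_image.2 ⟨0, by simp, by simp⟩) (by
      intro a ha
      simp only [I, Finset.mem_image, Finset.mem_Icc] at ha ⊢
      obtain ⟨k, hk, rfl⟩ := ha
      exact ⟨-k, by omega, by push_cast; rfl⟩)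
    rw [← Nat.cast_pow, ← hcard]
    congr 2
    ext x
    simp
  · intro h
    rw [thresholdArrangement, Finset.mem_image] at h
    obtain ⟨⟨i, j⟩, -, hij⟩ := h
    -- The all-ones vector lies on none of the hyperplanes, so none of them is the whole space.
    have : (fun _ => 1 : Fin n → ℝ) ∈ sumHyperplane i j := hij ▸ AffineSubspace.mem_top ℝ _ _
    rw [mem_sumHyperplane] at this
    norm_num at this

theorem card_thresholdColorings_zero {n : ℕ} (V : Finset (Fin n)) :
    (thresholdColorings V 0).card = if V.card ≤ 1 then 1 else 0 := by
  have hx0 : ∀ x ∈ thresholdColorings V 0, x = 0 := by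
    intro x hx
    rw [mem_thresholdColorings] at hx
    ext i
    by_cases hi : i ∈ V
    · have := hx.1 i hi
      simp only [Pi.zero_apply]
      omega
    · exact hx.2.1 i hi
  split_ifs with h
  · rw [Finset.card_eq_one]
    refine ⟨0, Finset.eq_singleton_iff_unique_mem.2 ⟨?_, hx0⟩⟩
    rw [mem_thresholdColorings]
    refine ⟨by simp, by simp, fun i hi j hj hij => ?_⟩
    exact absurd (Finset.card_le_one.1 h i hi j hj) hij
  · rw [Finset.card_eq_zero, Finset.eq_empty_iff_forall_notMem]
    intro x hx
    rw [not_le, Finset.one_lt_card] at h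
    obtain ⟨i, hi, j, hj, hij⟩ := h
    have h2 := (mem_thresholdColorings.1 hx).2.2 i hi j hj hij
    rw [hx0 x hx] at h2
    simp at h2

/-- Classify points by the set `T` of coordinates of absolute value `m + 1`. These coordinates
cannot cancel in pairs, so they share one sign, and they cannot cancel against the smaller
coordinates, which form an arbitrary point for `m`. -/
theorem card_thresholdColorings_succ {n : ℕ} (V : Finset (Fin n)) (m : ℕ) :
    (thresholdColorings V (m + 1)).card =
      ∑ T ∈ V.powerset, (if T.card = 0 then 1 else 2) * (thresholdColorings (V \ T) m).card := by
  classical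
  let f : (Fin n → ℤ) → Finset (Fin n) := fun x =>
    V.filter fun i => x i = m + 1 ∨ x i = -(m + 1)
  rw [Finset.card_eq_sum_card_fiberwise (f := f) (t := V.powerset)
    (fun x _ => Finset.mem_coe.2 (Finset.mem_powerset.2 (Finset.filter_subset _ _)))]
  refine Finset.sum_congr rfl fun T hT => ?_
  rw [Finset.mem_powerset] at hT
  -- The possible common signs on `T`; for empty `T` the sign is fixed to be `1` so that the
  -- parametrization is injective.
  let s : Finset ℤ := if T.card = 0 then {1} else {1, -1}
  have hs : s.card = if T.card = 0 then 1 else 2 := by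
    simp only [s]
    split_ifs <;> rfl
  have hs1 : ∀ a ∈ s, a = 1 ∨ a = -1 := by
    intro a ha
    simp only [s] at ha
    split_ifs at ha <;> simp at ha <;> tauto
  have hs2 : T.Nonempty → s = {1, -1} := by
    intro h
    simp only [s]
    rw [if_neg h.card_pos.ne']
  rw [← hs, ← Finset.card_product]
  symm
  refine Finset.card_bij (fun p _ i => if i ∈ T then p.1 * (m + 1) else p.2 i) ?_ ?_ ?_
  · rintro ⟨a, y⟩ hp
    rw [Finset.mem_product] at hp
    obtain ⟨ha, hy⟩ := hp
    rw [mem_thresholdColorings] at hy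
    replace ha := hs1 a ha
    simp only [Finset.mem_sdiff] at hy
    rw [Finset.mem_filter, mem_thresholdColorings]
    refine ⟨⟨fun i hi => ?_, fun i hi => ?_, fun i hi j hj hij => ?_⟩, ?_⟩
    · by_cases hiT : i ∈ T
      · rcases ha with rfl | rfl <;> simp [hiT] <;> omega
      · have := hy.1 i ⟨hi, hiT⟩
        simp only [hiT, if_false]
        push_cast
        omega
    · have hiT : i ∉ T := fun h => hi (hT h)
      simp only [hiT, if_false]
      exact hy.2.1 i fun h => hi h.1
    · by_cases hiT : i ∈ T <;> by_cases hjT : j ∈ T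
      · rcases ha with rfl | rfl <;> simp [hiT, hjT] <;> omega
      · have := hy.1 j ⟨hj, hjT⟩
        rcases ha with rfl | rfl <;> simp [hiT, hjT] <;> omega
      · have := hy.1 i ⟨hi, hiT⟩
        rcases ha with rfl | rfl <;> simp [hiT, hjT] <;> omega
      · simp only [hiT, hjT, if_false]
        exact hy.2.2 i ⟨hi, hiT⟩ j ⟨hj, hjT⟩ hij
    · ext i
      simp only [f, Finset.mem_filter]
      constructor
      · rintro ⟨hi, h⟩
        by_contra hiT
        have := hy.1 i ⟨hi, hiT⟩
        simp only [hiT, if_false] at h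
        omega
      · intro hiT
        refine ⟨hT hiT, ?_⟩
        rcases ha with rfl | rfl <;> simp [hiT]
  · rintro ⟨a, y⟩ hp ⟨a', y'⟩ hp' h
    rw [Finset.mem_product] at hp hp'
    obtain ⟨ha, hy⟩ := hp
    obtain ⟨ha', hy'⟩ := hp'
    rw [mem_thresholdColorings] at hy hy'
    dsimp only at *
    have hyy : y = y' := by
      ext i
      by_cases hiT : i ∈ T
      · rw [hy.2.1 i (by simp [hiT]), hy'.2.1 i (by simp [hiT])]
      · simpa [hiT] using congrFun h i
    have haa : a = a' := by
      rcases T.eq_empty_or_nonempty with rfl | ⟨i, hi⟩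
      · simp [s] at ha ha'
        rw [ha, ha']
      · have := congrFun h i
        simp only [hi, if_true] at this
        have hm : (m : ℤ) + 1 ≠ 0 := by omega
        exact mul_right_cancel₀ hm this
    rw [hyy, haa]
  · intro x hx
    rw [Finset.mem_filter, mem_thresholdColorings] at hx
    obtain ⟨⟨h1, h2, h3⟩, hf⟩ := hx
    have hTx : ∀ i ∈ T, x i = m + 1 ∨ x i = -(m + 1) := by
      intro i hi
      rw [← hf] at hi
      exact (Finset.mem_filter.1 hi).2
    have hxT : ∀ i ∈ V, i ∉ T → x i ≠ m + 1 ∧ x i ≠ -(m + 1) := by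
      intro i hi hiT
      rw [← hf, Finset.mem_filter] at hiT
      tauto
    obtain ⟨a, ha, hax⟩ : ∃ a ∈ s, ∀ i ∈ T, x i = a * (m + 1) := by
      rcases T.eq_empty_or_nonempty with rfl | ⟨j, hj⟩
      · exact ⟨1, by simp [s], by simp⟩
      · rw [hs2 ⟨j, hj⟩]
        rcases hTx j hj with hxj | hxj
        · refine ⟨1, by simp, fun i hi => ?_⟩
          by_cases hij : i = j
          · rw [hij, hxj, one_mul]
          · have := h3 i (hT hi) j (hT hj) hij
            rcases hTx i hi with h | h <;> omega
        · refine ⟨-1, by simp, fun i hi => ?_⟩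
          by_cases hij : i = j
          · rw [hij, hxj, neg_one_mul]
          · have := h3 i (hT hi) j (hT hj) hij
            rcases hTx i hi with h | h <;> omega
    refine ⟨(a, fun i => if i ∈ T then 0 else x i), ?_, ?_⟩
    · rw [Finset.mem_product, mem_thresholdColorings]
      refine ⟨ha, fun i hi => ?_, fun i hi => ?_, fun i hi j hj hij => ?_⟩
      · rw [Finset.mem_sdiff] at hi
        have h4 := hxT i hi.1 hi.2
        have h5 := h1 i hi.1
        push_cast at h5
        simp only [hi.2, if_false]
        omega
      · by_cases hiT : i ∈ T
        · simp [hiT]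
        · simp only [hiT, if_false]
          exact h2 i fun h => hi (Finset.mem_sdiff.2 ⟨h, hiT⟩)
      · rw [Finset.mem_sdiff] at hi hj
        simp only [hi.2, hj.2, if_false]
        exact h3 i hi.1 j hj.1 hij
    · ext i
      by_cases hiT : i ∈ T
      · simp [hiT, hax i hiT]
      · simp [hiT]

end FinitePointCount

/-! ### Exponential generating functions and their differential equations. -/

section ExponentialGeneratingFunctions

open PowerSeries

/-- The exponential generating function of a sequence. -/
noncomputable def egf (f : ℕ → ℚ) : ℚ⟦X⟧ := PowerSeries.mk fun n => f n / n.factorial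

/-- The binomial convolution of two sequences. -/
def binomialConvolution (f g : ℕ → ℚ) (n : ℕ) : ℚ :=
  ∑ k ∈ Finset.range (n + 1), n.choose k * (f k * g (n - k))

theorem sum_powerset_mul_eq_binomialConvolution {β : Type*} [DecidableEq β] (f g : ℕ → ℚ)
    (V : Finset β) :
    ∑ T ∈ V.powerset, f T.card * g (V \ T).card = binomialConvolution f g V.card := by
  have : ∀ T ∈ V.powerset, f T.card * g (V \ T).card =
      (fun k => f k * g (V.card - k)) T.card := by
    intro T hT
    rw [Finset.card_sdiff_of_subset (Finset.mem_powerset.1 hT)]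
  rw [Finset.sum_congr rfl this,
    Finset.sum_powerset_apply_card (fun k => f k * g (V.card - k)), binomialConvolution]
  simp only [nsmul_eq_mul]

theorem egf_injective : Function.Injective egf := by
  intro f g h
  ext n
  have := congrArg (coeff n) h
  simp only [egf, coeff_mk] at this
  have hn : (n.factorial : ℚ) ≠ 0 := by positivity
  field_simp at this
  exact this

theorem egf_mul (f g : ℕ → ℚ) : egf f * egf g = egf (binomialConvolution f g) := by
  ext n
  simp only [egf, coeff_mul, coeff_mk, binomialConvolution]
  rw [Finset.Nat.sum_antidiagonal_eq_sum_range_succ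
    (fun i j => f i / (i.factorial : ℚ) * (g j / (j.factorial : ℚ))), Finset.sum_div]
  refine Finset.sum_congr rfl fun k hk => ?_
  have hk' : k ≤ n := Nat.lt_succ_iff.1 (Finset.mem_range.1 hk)
  rw [Nat.cast_choose ℚ hk']
  have h1 : (n.factorial : ℚ) ≠ 0 := by positivity
  have h2 : (k.factorial : ℚ) ≠ 0 := by positivity
  have h3 : ((n - k).factorial : ℚ) ≠ 0 := by positivity
  field_simp

theorem derivative_egf (f : ℕ → ℚ) : d⁄dX ℚ (egf f) = egf fun n => f (n + 1) := by
  ext n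
  rw [coeff_derivative]
  simp only [egf, coeff_mk, Nat.factorial_succ]
  push_cast
  have h1 : (n.factorial : ℚ) ≠ 0 := by positivity
  field_simp

theorem egf_const_mul (c : ℚ) (f : ℕ → ℚ) : egf (fun n => c * f n) = C c * egf f := by
  ext n
  simp only [egf, coeff_mk, coeff_C_mul, mul_div_assoc]

theorem egf_sub (f g : ℕ → ℚ) : egf (fun n => f n - g n) = egf f - egf g := by
  ext n
  simp only [egf, coeff_mk, map_sub, sub_div]

theorem egf_one : egf (fun _ => 1) = exp ℚ := by
  ext n
  simp [egf]

theorem egf_ite_zero : egf (fun n => if n = 0 then 1 else 0) = 1 := by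
  ext n
  rcases n with _ | n <;> simp [egf, coeff_one]

theorem X_mul_egf (f : ℕ → ℚ) : X * egf f = egf fun n => n * f (n - 1) := by
  ext n
  rcases n with _ | n
  · simp [egf]
  · rw [mul_comm, coeff_succ_mul_X]
    simp only [egf, coeff_mk, Nat.factorial_succ, Nat.add_sub_cancel]
    push_cast
    have h1 : (n.factorial : ℚ) ≠ 0 := by positivity
    field_simp

theorem rescale_neg_one_egf (f : ℕ → ℚ) :
    rescale (-1) (egf f) = egf fun n => (-1) ^ n * f n := by
  ext n
  simp only [egf, coeff_rescale, coeff_mk, mul_div_assoc]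

/-- The zero series is the only solution of a homogeneous linear differential equation of first order
with zero constant coefficient. -/
theorem eq_zero_of_derivative_eq_mul {f g : ℚ⟦X⟧} (h : d⁄dX ℚ f = g * f)
    (h0 : constantCoeff f = 0) : f = 0 := by
  have key : ∀ n, ∀ k ≤ n, coeff k f = 0 := by
    intro n
    induction n with
    | zero =>
      intro k hk
      obtain rfl : k = 0 := by omega
      simpa using h0
    | succ n ih =>
      intro k hk
      rcases Nat.lt_or_ge n k with hn | hn
      · obtain rfl : k = n + 1 := by omega
        have h1 := congrArg (coeff n) h
        rw [coeff_derivative, coeff_mul] at h1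
        rw [Finset.sum_eq_zero] at h1
        · have : (n : ℚ) + 1 ≠ 0 := by positivity
          simpa [this] using h1
        · intro p hp
          rw [Finset.HasAntidiagonal.mem_antidiagonal] at hp
          rw [ih p.2 (by omega), mul_zero]
      · exact ih k hn
  ext n
  simpa using key n n le_rfl

theorem eq_of_derivative_eq_mul {f₁ f₂ g : ℚ⟦X⟧} (h₁ : d⁄dX ℚ f₁ = g * f₁)
    (h₂ : d⁄dX ℚ f₂ = g * f₂) (h0 : constantCoeff f₁ = constantCoeff f₂) : f₁ = f₂ := by
  refine sub_eq_zero.1 (eq_zero_of_derivative_eq_mul (g := g) ?_ ?_)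
  · rw [map_sub, h₁, h₂, mul_sub]
  · rw [map_sub, h0, sub_self]

theorem constantCoeff_egf (f : ℕ → ℚ) : constantCoeff (egf f) = f 0 := by
  rw [← coeff_zero_eq_constantCoeff_apply]
  simp [egf]

theorem derivative_rescale_neg_one_exp :
    d⁄dX ℚ (rescale (-1 : ℚ) (exp ℚ)) = -rescale (-1 : ℚ) (exp ℚ) := by
  rw [← egf_one, rescale_neg_one_egf, derivative_egf]
  ext n
  simp only [egf, coeff_mk, map_neg, pow_succ]
  ring

theorem exp_mul_rescale_neg_one_exp : exp ℚ * rescale (-1 : ℚ) (exp ℚ) = 1 := by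
  have h := exp_mul_exp_neg_eq_one (A := ℚ)
  rwa [evalNegHom] at h

/-- The recurrence of the differential equation `dr/dx = r (2 r - 1)` with `r(0) = 1` has the
exponential generating function `1 / (2 - e ^ x)`. -/
theorem egf_mul_two_sub_exp {r : ℕ → ℚ} (h0 : r 0 = 1)
    (hr : ∀ n, r (n + 1) =
      binomialConvolution r (fun k => 2 * r k - if k = 0 then 1 else 0) n) :
    egf r * (2 - exp ℚ) = 1 := by
  have hd : d⁄dX ℚ (egf r) = egf r * (C 2 * egf r - 1) := by
    rw [derivative_egf, ← egf_ite_zero, ← egf_const_mul, ← egf_sub, egf_mul]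
    exact congrArg egf (funext hr)
  have hC : (C (2 : ℚ) : ℚ⟦X⟧) = 2 := map_ofNat C 2
  rw [hC] at hd
  have h2 : d⁄dX ℚ (2 : ℚ⟦X⟧) = 0 := by rw [← hC, derivative_C]
  -- With `R = egf r`, the difference `f = R (2 - e^x) - 1` satisfies `f' = 2 R f`.
  refine sub_eq_zero.1 (eq_zero_of_derivative_eq_mul (g := 2 * egf r) ?_ ?_)
  · rw [map_sub, Derivation.leibniz, map_sub, derivative_exp, hd, h2, derivative_one]
    simp only [smul_eq_mul]
    ring
  · rw [map_sub, map_mul, map_sub, constantCoeff_egf, h0, constantCoeff_exp, map_one, ← hC,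
      constantCoeff_C]
    norm_num

/-- The recurrence says `A' = -2m R A`. Since `R (2e^{-x} - 1) = e^{-x}`, the power on the right
solves the same equation with the same constant term. -/
theorem egf_eq_two_mul_exp_neg_sub_one_pow {r a : ℕ → ℚ} {m : ℕ} (hR : egf r * (2 - exp ℚ) = 1)
    (ha0 : a 0 = 1) (ha : ∀ n, a (n + 1) = (-2 * m) * binomialConvolution r a n) :
    egf a = (2 * rescale (-1 : ℚ) (exp ℚ) - 1) ^ m := by
  set E := rescale (-1 : ℚ) (exp ℚ) with hE
  have hC : (C (2 : ℚ) : ℚ⟦X⟧) = 2 := map_ofNat C 2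
  have h2 : d⁄dX ℚ (2 : ℚ⟦X⟧) = 0 := by rw [← hC, derivative_C]
  have hRE : egf r * (2 * E - 1) = E := by
    linear_combination E * hR + egf r * exp_mul_rescale_neg_one_exp
  refine eq_of_derivative_eq_mul (g := C (-2 * m : ℚ) * egf r) ?_ ?_ ?_
  · rw [derivative_egf, mul_assoc, egf_mul, ← egf_const_mul]
    exact congrArg egf (funext ha)
  · have hCm : (C (-2 * m : ℚ) : ℚ⟦X⟧) = -2 * m := by simp [hC]
    rw [derivative_pow, map_sub, Derivation.leibniz, derivative_rescale_neg_one_exp, ← hE, h2,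
      derivative_one, hCm]
    simp only [smul_eq_mul]
    -- The derivative of the power contains the truncated exponent `m - 1`, so `m = 0` is separate.
    rcases m with _ | m
    · simp
    · rw [pow_succ, Nat.add_sub_cancel]
      linear_combination (2 * ((m + 1 : ℕ) : ℚ⟦X⟧) * (2 * E - 1) ^ m) * hRE
  · have : constantCoeff E = 1 := by
      rw [hE, ← coeff_zero_eq_constantCoeff_apply, coeff_rescale]
      simp
    rw [constantCoeff_egf, ha0, map_pow, map_sub, map_mul, this, map_one, ← hC, constantCoeff_C]
    norm_num

/-- The number of points of `{-m, …, m}^n` without zero pairwise sums of coordinates. -/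
def numThresholdColorings : ℕ → ℕ → ℚ
  | 0 => fun n => if n ≤ 1 then 1 else 0
  | m + 1 => binomialConvolution (fun k => if k = 0 then 1 else 2) (numThresholdColorings m)

theorem card_thresholdColorings {n : ℕ} (m : ℕ) (V : Finset (Fin n)) :
    ((thresholdColorings V m).card : ℚ) = numThresholdColorings m V.card := by
  induction m generalizing V with
  | zero => 
    rw [card_thresholdColorings_zero, numThresholdColorings]
    push_cast
    rfl
  | succ m ih =>
    rw [card_thresholdColorings_succ, numThresholdColorings]
    push_cast
    simp only [ih]
    rw [← sum_powerset_mul_eq_binomialConvolution]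

/-- The factor `1 + X` comes from `m = 0`, where at most one coordinate is allowed; each further
layer multiplies by `2e^x - 1`, the series of the weights `1, 2, 2, …`. -/
theorem egf_numThresholdColorings (m : ℕ) :
    egf (numThresholdColorings m) = (1 + X) * (2 * exp ℚ - 1) ^ m := by
  have hC : (C (2 : ℚ) : ℚ⟦X⟧) = 2 := map_ofNat C 2
  induction m with
  | zero =>
    rw [pow_zero, mul_one]
    ext n
    rcases n with _ | _ | n <;> simp [egf, numThresholdColorings, coeff_one, coeff_X]
  | succ m ih =>
    have h : egf (fun k => if k = 0 then 1 else 2) = 2 * exp ℚ - 1 := by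
      rw [← egf_ite_zero, ← egf_one, ← hC, ← egf_const_mul, ← egf_sub]
      congr 1
      ext k
      split_ifs <;> norm_num
    rw [numThresholdColorings, ← egf_mul, ih, h]
    ring

/-- The series of `a n - n * a (n - 1)` is `(1 - x)(2e^{-x} - 1)^m`, and the sign `(-1) ^ n`
substitutes `-x` for `x`. -/
theorem numThresholdColorings_eq {r a : ℕ → ℚ} {m : ℕ} (hr0 : r 0 = 1)
    (hr : ∀ n, r (n + 1) = binomialConvolution r (fun k => 2 * r k - if k = 0 then 1 else 0) n)
    (ha0 : a 0 = 1) (ha : ∀ n, a (n + 1) = (-2 * m) * binomialConvolution r a n) (n : ℕ) :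
    numThresholdColorings m n = (-1) ^ n * (a n - n * a (n - 1)) := by
  have hinv : rescale (-1 : ℚ) (rescale (-1 : ℚ) (exp ℚ)) = exp ℚ := by
    rw [rescale_rescale]
    norm_num
  have hC : (C (2 : ℚ) : ℚ⟦X⟧) = 2 := map_ofNat C 2
  suffices h : numThresholdColorings m = fun n => (-1) ^ n * (a n - n * a (n - 1)) from congrFun h n
  apply egf_injective
  rw [egf_numThresholdColorings, ← rescale_neg_one_egf, egf_sub, ← X_mul_egf,
    egf_eq_two_mul_exp_neg_sub_one_pow (egf_mul_two_sub_exp hr0 hr) ha0 ha]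
  rw [map_sub, map_mul, map_pow, map_sub, map_mul, hinv, map_one, rescale_neg_one_X, map_ofNat]
  ring

end ExponentialGeneratingFunctions

/-! ### Enumeration of sorted words by splitting at the least label. -/

section SortedWords

theorem append_cons_inj_of_label_notMem {α : Type*} {u v u' v' : List (α × Bool)} {a : α} {σ σ' : Bool}
    (hu : a ∉ u.map Prod.fst) (hu' : a ∉ u'.map Prod.fst)
    (h : u ++ (a, σ) :: v = u' ++ (a, σ') :: v') : u = u' ∧ σ = σ' ∧ v = v' := by
  induction u generalizing u' with
  | nil =>
    rcases u' with _ | ⟨x, u'⟩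
    · simpa using h
    · simp only [List.nil_append, List.cons_append, List.cons.injEq] at h
      exact absurd (by simp [← h.1]) hu'
  | cons x u ih =>
    rcases u' with _ | ⟨y, u'⟩
    · simp only [List.nil_append, List.cons_append, List.cons.injEq] at h
      exact absurd (by simp [h.1]) hu
    · simp only [List.cons_append, List.cons.injEq] at h
      simp only [List.map_cons, List.mem_cons, not_or] at hu hu'
      obtain ⟨rfl, h2, h3⟩ := ih hu.2 hu'.2 h.2
      exact ⟨by rw [h.1], h2, h3⟩

variable {α : Type*} [LinearOrder α]

/-- A word of labelled vertices with their types, in the order of addition, is sorted if labels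
increase along each maximal run of vertices of the same type. -/
def IsSortedWord (l : List (α × Bool)) : Prop :=
  l.IsChain fun a b => a.2 = b.2 → a.1 < b.1

/-- The number of anchors of a word whose type differs from that of the previous anchor, where the
first anchor is compared with `τ`. -/
def oddAnchorCount : Bool → List (α × Bool) → ℕ
  | _, [] => 0
  | τ, a :: l =>
    if ∀ b ∈ l, a.1 < b.1 then (if a.2 = τ then 0 else 1) + oddAnchorCount a.2 l
    else oddAnchorCount τ l

/-- No letter before the least label is an anchor, so the least label is the first anchor and its
type is the reference for the rest. -/
theorem oddAnchorCount_append_cons (τ σ : Bool) (a : α) (u v : List (α × Bool))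
    (hu : ∀ x ∈ u, a < x.1) (hv : ∀ x ∈ v, a < x.1) :
    oddAnchorCount τ (u ++ (a, σ) :: v) = (if σ = τ then 0 else 1) + oddAnchorCount σ v := by
  induction u with
  | nil => rw [List.nil_append, oddAnchorCount, if_pos hv]
  | cons x u ih =>
    rw [List.cons_append, oddAnchorCount, if_neg, ih fun y hy => hu y (List.mem_cons_of_mem _ hy)]
    intro h
    exact lt_asymm (h (a, σ) (by simp)) (hu x List.mem_cons_self)

/-- The last letter of the word, if there is one, is not of type `σ`. -/
def NotEndingWith {α : Type*} (σ : Bool) (l : List (α × Bool)) : Prop :=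
  ∀ x ∈ l.getLast?, x.2 ≠ σ

theorem notEndingWith_append_cons {α : Type*} (σ : Bool) (u v : List (α × Bool)) (a : α × Bool) :
    NotEndingWith σ (u ++ a :: v) ↔ (v = [] → a.2 ≠ σ) ∧ NotEndingWith σ v := by
  rcases v.eq_nil_or_concat with rfl | ⟨w, x, rfl⟩
  · simp [NotEndingWith]
  · have : u ++ a :: w.concat x = (u ++ a :: w).concat x := by simp
    rw [this]
    unfold NotEndingWith
    rw [List.concat_eq_append, List.concat_eq_append, List.getLast?_concat, List.getLast?_concat]
    simp

theorem notEndingWith_nil {α : Type*} (σ : Bool) : NotEndingWith σ ([] : List (α × Bool)) := by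
  simp [NotEndingWith]

/-- At the least label a descent occurs on the left and an ascent on the right. So the left
neighbour must have another type, while the right one is unrestricted. -/
theorem isSortedWord_append_cons {a : α} {σ : Bool} {u v : List (α × Bool)}
    (hu : ∀ x ∈ u, a < x.1) (hv : ∀ x ∈ v, a < x.1) :
    IsSortedWord (u ++ (a, σ) :: v) ↔ IsSortedWord u ∧ NotEndingWith σ u ∧ IsSortedWord v := by
  unfold IsSortedWord NotEndingWith
  rw [List.isChain_append, List.isChain_cons]
  constructor
  · rintro ⟨h1, ⟨-, h2⟩, h3⟩
    refine ⟨h1, fun x hx h => ?_, h2⟩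
    exact lt_asymm (hu x (List.mem_of_getLast? hx)) (h3 x hx (a, σ) (by simp) h)
  · rintro ⟨h1, h2, h3⟩
    refine ⟨h1, ⟨fun y hy _ => hv y (List.mem_of_mem_head? hy), h3⟩, fun x hx y hy h => ?_⟩
    simp only [List.head?_cons, Option.mem_def, Option.some.injEq] at hy
    subst hy
    exact absurd h (h2 x hx)

theorem exists_eq_insert_min {V : Finset α} (hV : V.Nonempty) :
    ∃ a V', V = insert a V' ∧ (∀ x ∈ V', a < x) ∧ V.card = V'.card + 1 := by
  refine ⟨V.min' hV, V.erase (V.min' hV), (Finset.insert_erase (V.min'_mem hV)).symm,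
    fun x hx => V.min'_lt_of_mem_erase_min' hV hx, ?_⟩
  rw [Finset.card_erase_add_one (V.min'_mem hV)]

variable [Finite α]

theorem finite_sortedWords (V : Finset α) :
    {l : List (α × Bool) | (l.map Prod.fst).Nodup ∧ (∀ a, a ∈ l.map Prod.fst ↔ a ∈ V) ∧
      IsSortedWord l}.Finite := by
  refine (List.finite_length_eq (α × Bool) V.card).subset ?_
  rintro l ⟨h1, h2, -⟩
  have : (l.map Prod.fst).toFinset = V := by
    ext a
    rw [List.mem_toFinset, h2]
  rw [Set.mem_ofPred_eq, ← this, List.toFinset_card_of_nodup h1, List.length_map]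

/-- The sorted words in which each label from `V` occurs once. -/
noncomputable def sortedWords (V : Finset α) : Finset (List (α × Bool)) :=
  (finite_sortedWords V).toFinset

theorem mem_sortedWords {V : Finset α} {l : List (α × Bool)} :
    l ∈ sortedWords V ↔ (l.map Prod.fst).Nodup ∧ (∀ a, a ∈ l.map Prod.fst ↔ a ∈ V) ∧
      IsSortedWord l := by
  rw [sortedWords, Set.Finite.mem_toFinset, Set.mem_ofPred_eq]

theorem label_mem_of_mem_sortedWords {V : Finset α} {l : List (α × Bool)} (hl : l ∈ sortedWords V)
    {x : α × Bool} (hx : x ∈ l) : x.1 ∈ V :=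
  ((mem_sortedWords.1 hl).2.1 x.1).1 (List.mem_map_of_mem hx)

theorem sortedWords_empty : sortedWords (∅ : Finset α) = {[]} := by
  ext l
  rw [mem_sortedWords, Finset.mem_singleton]
  constructor
  · rintro ⟨-, h, -⟩
    rw [List.eq_nil_iff_forall_not_mem]
    intro x hx
    exact absurd ((h x.1).1 (List.mem_map_of_mem hx)) (by simp)
  · rintro rfl
    simp [IsSortedWord]

theorem ne_nil_of_mem_sortedWords {V : Finset α} (hV : V.Nonempty) {l : List (α × Bool)}
    (hl : l ∈ sortedWords V) : l ≠ [] := by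
  rintro rfl
  obtain ⟨a, ha⟩ := hV
  simpa using ((mem_sortedWords.1 hl).2.1 a).2 ha

open scoped Classical in
/-- The sorted words with label set `V` that do not end with a letter of type `σ`. -/
noncomputable def sortedWordsNotEndingWith (σ : Bool) (V : Finset α) :
    Finset (List (α × Bool)) :=
  (sortedWords V).filter fun l => NotEndingWith σ l

open scoped Classical in
theorem mem_sortedWordsNotEndingWith {σ : Bool} {V : Finset α} {l : List (α × Bool)} :
    l ∈ sortedWordsNotEndingWith σ V ↔ l ∈ sortedWords V ∧ NotEndingWith σ l := by
  rw [sortedWordsNotEndingWith, Finset.mem_filter]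

theorem append_cons_mem_sortedWords {V U : Finset α} {a : α} (ha : ∀ x ∈ V, a < x) (hU : U ⊆ V)
    {σ : Bool} {u v : List (α × Bool)} (hu : u ∈ sortedWordsNotEndingWith σ U)
    (hv : v ∈ sortedWords (V \ U)) : u ++ (a, σ) :: v ∈ sortedWords (insert a V) := by
  rw [mem_sortedWordsNotEndingWith] at hu
  have hua : ∀ x ∈ u, a < x.1 := fun x hx => ha _ (hU (label_mem_of_mem_sortedWords hu.1 hx))
  have hva : ∀ x ∈ v, a < x.1 := fun x hx =>
    ha _ (Finset.mem_sdiff.1 (label_mem_of_mem_sortedWords hv hx)).1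
  have hu' := mem_sortedWords.1 hu.1
  have hv' := mem_sortedWords.1 hv
  rw [mem_sortedWords, isSortedWord_append_cons hua hva]
  refine ⟨?_, fun x => ?_, hu'.2.2, hu.2, hv'.2.2⟩
  · rw [List.map_append, List.map_cons, List.nodup_append', List.nodup_cons]
    refine ⟨hu'.1, ⟨?_, hv'.1⟩, ?_⟩
    · rw [hv'.2.1]
      exact fun h => lt_irrefl _ (ha a (Finset.mem_sdiff.1 h).1)
    · intro x hx hx'
      rw [hu'.2.1] at hx
      rw [List.mem_cons, hv'.2.1, Finset.mem_sdiff] at hx'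
      rcases hx' with rfl | hx'
      · exact lt_irrefl _ (ha _ (hU hx))
      · exact hx'.2 hx
  · rw [List.map_append, List.map_cons, List.mem_append, List.mem_cons, hu'.2.1, hv'.2.1,
      Finset.mem_insert, Finset.mem_sdiff]
    by_cases hx : x ∈ U
    · simp [hx, hU hx]
    · simp [hx]

theorem exists_eq_append_cons_of_mem_sortedWords {V : Finset α} {a : α} (ha : ∀ x ∈ V, a < x)
    {l : List (α × Bool)} (hl : l ∈ sortedWords (insert a V)) :
    ∃ U ⊆ V, ∃ σ, ∃ u ∈ sortedWordsNotEndingWith σ U, ∃ v ∈ sortedWords (V \ U),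
      l = u ++ (a, σ) :: v := by
  have hl' := mem_sortedWords.1 hl
  obtain ⟨⟨a', σ⟩, hmem, rfl⟩ := List.mem_map.1 ((hl'.2.1 a).2 (Finset.mem_insert_self a V))
  dsimp only at *
  obtain ⟨u, v, rfl⟩ := List.append_of_mem hmem
  obtain ⟨h1, h2, h3⟩ := hl'
  rw [List.map_append, List.map_cons, List.nodup_append', List.nodup_cons] at h1
  simp only [List.map_append, List.map_cons, List.mem_append, List.mem_cons,
    Finset.mem_insert] at h2
  obtain ⟨hu, ⟨hav, hv⟩, hd⟩ := h1
  have hau : a' ∉ u.map Prod.fst := fun h => hd h (by simp)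
  have huV : ∀ x ∈ u.map Prod.fst, x ∈ V := by
    intro x hx
    rcases (h2 x).1 (Or.inl hx) with rfl | h
    · exact absurd hx hau
    · exact h
  have hvV : ∀ x ∈ v.map Prod.fst, x ∈ V := by
    intro x hx
    rcases (h2 x).1 (Or.inr (Or.inr hx)) with rfl | h
    · exact absurd hx hav
    · exact h
  rw [isSortedWord_append_cons (fun x hx => ha _ (huV _ (List.mem_map_of_mem hx)))
    (fun x hx => ha _ (hvV _ (List.mem_map_of_mem hx)))] at h3
  have huU : ∀ x, x ∈ u.map Prod.fst ↔ x ∈ (u.map Prod.fst).toFinset := by simp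
  refine ⟨(u.map Prod.fst).toFinset, fun x hx => huV x (List.mem_toFinset.1 hx), σ, u, ?_, v, ?_,
    rfl⟩
  · rw [mem_sortedWordsNotEndingWith, mem_sortedWords]
    exact ⟨⟨hu, huU, h3.1⟩, h3.2.1⟩
  · rw [mem_sortedWords]
    refine ⟨hv, fun x => ?_, h3.2.2⟩
    rw [Finset.mem_sdiff, ← huU]
    constructor
    · exact fun hx => ⟨hvV x hx, fun hx' => hd hx' (List.mem_cons_of_mem _ hx)⟩
    · rintro ⟨hx, hxu⟩
      rcases (h2 x).2 (Or.inr hx) with h | rfl | h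
      · exact absurd h hxu
      · exact absurd (ha x hx) (lt_irrefl x)
      · exact h

/-- A sorted word splits at its least label into two sorted words. -/
theorem sum_sortedWords_insert {M : Type*} [AddCommMonoid M] {V : Finset α} {a : α}
    (ha : ∀ x ∈ V, a < x) (F : List (α × Bool) → M) :
    ∑ l ∈ sortedWords (insert a V), F l = ∑ U ∈ V.powerset, ∑ σ : Bool,
      ∑ u ∈ sortedWordsNotEndingWith σ U, ∑ v ∈ sortedWords (V \ U), F (u ++ (a, σ) :: v) := by
  have hau : ∀ U ⊆ V, ∀ σ, ∀ u ∈ sortedWordsNotEndingWith σ U, a ∉ u.map Prod.fst := by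
    intro U hU σ u hu h
    rw [(mem_sortedWords.1 (mem_sortedWordsNotEndingWith.1 hu).1).2.1] at h
    exact lt_irrefl a (ha a (hU h))
  simp only [Finset.sum_sigma']
  symm
  refine Finset.sum_bij (fun p _ => p.2.2.1 ++ (a, p.2.1) :: p.2.2.2) ?_ ?_ ?_ (fun _ _ => rfl)
  · rintro ⟨U, σ, u, v⟩ hp
    simp only [Finset.mem_sigma, Finset.mem_powerset] at hp
    exact append_cons_mem_sortedWords ha hp.1 hp.2.2.1 hp.2.2.2
  · rintro ⟨U, σ, u, v⟩ hp ⟨U', σ', u', v'⟩ hp' h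
    simp only [Finset.mem_sigma, Finset.mem_powerset] at hp hp'
    dsimp only at h
    obtain ⟨rfl, rfl, rfl⟩ := append_cons_inj_of_label_notMem (hau U hp.1 _ _ hp.2.2.1)
      (hau U' hp'.1 _ _ hp'.2.2.1) h
    obtain rfl : U = U' := by
      ext x
      rw [← (mem_sortedWords.1 (mem_sortedWordsNotEndingWith.1 hp.2.2.1).1).2.1,
        ← (mem_sortedWords.1 (mem_sortedWordsNotEndingWith.1 hp'.2.2.1).1).2.1]
    rfl
  · intro l hl
    obtain ⟨U, hU, σ, u, hu, v, hv, rfl⟩ := exists_eq_append_cons_of_mem_sortedWords ha hl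
    refine ⟨⟨U, σ, u, v⟩, ?_, rfl⟩
    simp only [Finset.mem_sigma, Finset.mem_powerset]
    exact ⟨hU, Finset.mem_univ _, hu, hv⟩

/-- The number of sorted words with `n` labels that do not end with a given type. -/
def numSortedWordsNotEndingWith : ℕ → ℚ
  | 0 => 1
  | n + 1 => ∑ k : Fin (n + 1), n.choose k * (numSortedWordsNotEndingWith k *
      (2 * numSortedWordsNotEndingWith (n - k) - if n - k = 0 then 1 else 0))

theorem numSortedWordsNotEndingWith_succ (n : ℕ) :
    numSortedWordsNotEndingWith (n + 1) = binomialConvolution numSortedWordsNotEndingWith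
      (fun k => 2 * numSortedWordsNotEndingWith k - if k = 0 then 1 else 0) n := by
  rw [numSortedWordsNotEndingWith, binomialConvolution, Finset.sum_range]

/-- The sum of `t ^ oddAnchorCount` over the sorted words with `n` labels. -/
def oddAnchorSum (t : ℚ) : ℕ → ℚ
  | 0 => 1
  | n + 1 => (1 + t) * ∑ k : Fin (n + 1), n.choose k *
      (numSortedWordsNotEndingWith k * oddAnchorSum t (n - k))

theorem oddAnchorSum_succ (t : ℚ) (n : ℕ) :
    oddAnchorSum t (n + 1) =
      (1 + t) * binomialConvolution numSortedWordsNotEndingWith (oddAnchorSum t) n := by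
  rw [oddAnchorSum, binomialConvolution, Finset.sum_range]

/-- Split at the least label. A nonempty right part alone decides the ending, which leaves both
types for the least label; if the right part is empty, the least label is last and has only one
type. This gives the factor `2 r - [k = 0]` of the recurrence, the same for both `σ`. -/
theorem card_sortedWordsNotEndingWith (σ : Bool) (V : Finset α) :
    ((sortedWordsNotEndingWith σ V).card : ℚ) = numSortedWordsNotEndingWith V.card := by
  classical
  induction hn : V.card using Nat.strong_induction_on generalizing σ V with
  | h n ih =>
  subst hn
  rcases V.eq_empty_or_nonempty with rfl | hV
  · have : sortedWordsNotEndingWith σ (∅ : Finset α) = {[]} := by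
      rw [sortedWordsNotEndingWith, sortedWords_empty, Finset.filter_singleton,
        if_pos (notEndingWith_nil σ)]
    simp [this, numSortedWordsNotEndingWith]
  · obtain ⟨a, V', rfl, ha, hc⟩ := exists_eq_insert_min hV
    rw [hc, numSortedWordsNotEndingWith_succ, ← sum_powerset_mul_eq_binomialConvolution,
      sortedWordsNotEndingWith, Finset.card_filter, sum_sortedWords_insert ha]
    push_cast
    refine Finset.sum_congr rfl fun U hU => ?_
    rw [Finset.mem_powerset] at hU
    have hcU := Finset.card_le_card hU
    have hcU' : (V' \ U).card ≤ V'.card := Finset.card_le_card Finset.sdiff_subset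
    have key : ∀ ρ : Bool, ∀ u : List (α × Bool), (∑ v ∈ sortedWords (V' \ U),
        if NotEndingWith σ (u ++ (a, ρ) :: v) then (1 : ℚ) else 0) =
        if (V' \ U).card = 0 then (if ρ = σ then 0 else 1)
        else numSortedWordsNotEndingWith (V' \ U).card := by
      intro ρ u
      simp only [notEndingWith_append_cons]
      split_ifs with h0 hρ
      · rw [Finset.card_eq_zero] at h0
        simp [h0, sortedWords_empty, hρ]
      · rw [Finset.card_eq_zero] at h0
        rw [h0, sortedWords_empty, Finset.sum_singleton,
          if_pos ⟨fun _ => hρ, notEndingWith_nil σ⟩]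
      · rw [← ih _ (by omega) σ (V' \ U) rfl, sortedWordsNotEndingWith, Finset.card_filter]
        push_cast
        refine Finset.sum_congr rfl fun v hv => if_congr ?_ rfl rfl
        have := ne_nil_of_mem_sortedWords (Finset.card_pos.1 (Nat.pos_of_ne_zero h0)) hv
        simp [this]
    simp only [key, Finset.sum_const, nsmul_eq_mul, ih U.card (by omega) _ U rfl, Fintype.sum_bool]
    split_ifs with h0 h1 h2 h2
    · simp [← h1] at h2
    · rw [h0, numSortedWordsNotEndingWith]; ring
    · rw [h0, numSortedWordsNotEndingWith]; ring
    · cases σ <;> simp at h1 h2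
    · ring

/-- Of the two types of the least label, one agrees with `τ` and has weight `1`, the other has
weight `t`; hence the factor `1 + t` and the independence of `τ`. -/
theorem sum_sortedWords_pow_oddAnchorCount (t : ℚ) (τ : Bool) (V : Finset α) :
    ∑ l ∈ sortedWords V, t ^ oddAnchorCount τ l = oddAnchorSum t V.card := by
  classical
  induction hn : V.card using Nat.strong_induction_on generalizing V τ with
  | h n ih =>
  subst hn
  rcases V.eq_empty_or_nonempty with rfl | hV
  · simp [sortedWords_empty, oddAnchorSum, oddAnchorCount]
  · obtain ⟨a, V', rfl, ha, hc⟩ := exists_eq_insert_min hV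
    rw [hc, oddAnchorSum_succ, ← sum_powerset_mul_eq_binomialConvolution,
      sum_sortedWords_insert ha, Finset.mul_sum]
    refine Finset.sum_congr rfl fun U hU => ?_
    rw [Finset.mem_powerset] at hU
    have hcU' : (V' \ U).card ≤ V'.card := Finset.card_le_card Finset.sdiff_subset
    have key : ∀ σ : Bool, ∀ u ∈ sortedWordsNotEndingWith σ U, (∑ v ∈ sortedWords (V' \ U),
        t ^ oddAnchorCount τ (u ++ (a, σ) :: v)) =
        (if σ = τ then 1 else t) * oddAnchorSum t (V' \ U).card := by
      intro σ u hu
      rw [← ih _ (by omega) σ (V' \ U) rfl, Finset.mul_sum]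
      refine Finset.sum_congr rfl fun v hv => ?_
      rw [oddAnchorCount_append_cons, pow_add]
      · split_ifs <;> simp
      · exact fun x hx => ha _ (hU (label_mem_of_mem_sortedWords
          (mem_sortedWordsNotEndingWith.1 hu).1 hx))
      · exact fun x hx => ha _ (Finset.sdiff_subset (label_mem_of_mem_sortedWords hv hx))
    rw [Fintype.sum_bool, Finset.sum_congr rfl (key true), Finset.sum_congr rfl (key false)]
    simp only [Finset.sum_const, nsmul_eq_mul, card_sortedWordsNotEndingWith]
    cases τ <;> simp <;> ring

/-- The word starts with the dominant vertex `o`, or with two vertices of the same type, the first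
of which is not `o`. -/
def IsConventionalWord (o : α) (l : List (α × Bool)) : Prop :=
  l.head? = some (o, true) ∨ ∃ a b w, l = a :: b :: w ∧ a.1 ≠ o ∧ a.2 = b.2

-- Deleting the first letter is a bijection from the non-conventional sorted words to the sorted
-- words lacking one label: the deleted type is recovered as `false` for `o`, and otherwise as the
-- opposite of the next type. The condition on `F` says that the deleted letter carries no weight.
open scoped Classical in
theorem sum_not_isConventionalWord {M : Type*} [AddCommMonoid M] {V : Finset α} {o : α}
    (ho : o ∈ V) (hV : ∀ x ∈ V, o ≤ x) (F : List (α × Bool) → M)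
    (hF : ∀ a w, (a.1 = o → a.2 = false) → (a.1 ≠ o → ∃ x ∈ w, x.1 < a.1) → F (a :: w) = F w) :
    ∑ l ∈ (sortedWords V).filter (fun l => ¬ IsConventionalWord o l), F l =
      ∑ a ∈ V, ∑ l ∈ sortedWords (V.erase a), F l := by
  rw [Finset.sum_sigma']
  have : Inhabited α := ⟨o⟩
  have label : ∀ l ∈ (sortedWords V).filter (fun l => ¬ IsConventionalWord o l),
      ∃ a w, l = a :: w ∧ a.1 ∈ V ∧ w ∈ sortedWords (V.erase a.1) ∧ (a.1 = o → a.2 = false) ∧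
        (a.1 ≠ o → ∃ b w', w = b :: w' ∧ a.2 = !b.2) := by
    intro l hl
    rw [Finset.mem_filter] at hl
    obtain ⟨hl, hc⟩ := hl
    rcases l with _ | ⟨a, w⟩
    · exact absurd rfl (ne_nil_of_mem_sortedWords ⟨o, ho⟩ hl)
    · have h := mem_sortedWords.1 hl
      simp only [List.map_cons, List.nodup_cons, List.mem_cons] at h
      refine ⟨a, w, rfl, (h.2.1 a.1).1 (Or.inl rfl), ?_, ?_, ?_⟩
      · rw [mem_sortedWords]
        refine ⟨h.1.2, fun x => ?_, h.2.2.tail⟩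
        rw [Finset.mem_erase, ← h.2.1]
        constructor
        · intro hx
          exact ⟨fun hxa => h.1.1 (hxa ▸ hx), Or.inr hx⟩
        · rintro ⟨hxa, rfl | hx⟩
          · exact absurd rfl hxa
          · exact hx
      · intro hao
        by_contra h2
        refine hc (Or.inl ?_)
        rw [Bool.not_eq_false] at h2
        rw [List.head?_cons, ← hao, ← h2]
      · intro hao
        rcases w with _ | ⟨b, w'⟩
        · have := (h.2.1 o).2 ho
          simp only [List.map_nil, List.not_mem_nil, or_false] at this
          exact absurd this.symm hao
        · refine ⟨b, w', rfl, ?_⟩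
          by_contra h2
          refine hc (Or.inr ⟨a, b, w', rfl, hao, ?_⟩)
          cases h3 : a.2 <;> cases h4 : b.2 <;> simp [h3, h4] at h2 ⊢
  choose! hd tl heq hmem htl ho1 ho2 using label
  refine Finset.sum_bij (fun l _ => ⟨(hd l).1, tl l⟩) ?_ ?_ ?_ ?_
  · intro l hl
    exact Finset.mem_sigma.2 ⟨hmem l hl, htl l hl⟩
  · intro l hl l' hl' h
    simp only [Sigma.mk.injEq, heq_eq_eq] at h
    rw [heq l hl, heq l' hl', h.2]
    congr 1
    refine Prod.ext h.1 ?_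
    by_cases hlo : (hd l).1 = o
    · rw [ho1 l hl hlo, ho1 l' hl' (h.1 ▸ hlo)]
    · obtain ⟨b, w, hw, hb⟩ := ho2 l hl hlo
      obtain ⟨b', w', hw', hb'⟩ := ho2 l' hl' (h.1 ▸ hlo)
      rw [h.2, hw', List.cons.injEq] at hw
      rw [hb, hb', hw.1]
  · rintro ⟨a, w⟩ hw
    rw [Finset.mem_sigma] at hw
    obtain ⟨ha, hw⟩ := hw
    dsimp only at ha hw
    have hw' := mem_sortedWords.1 hw
    have hmemV : ∀ τ : Bool, IsSortedWord ((a, τ) :: w) → (a, τ) :: w ∈ sortedWords V := by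
      intro τ hτ
      rw [mem_sortedWords]
      refine ⟨?_, fun x => ?_, hτ⟩
      · rw [List.map_cons, List.nodup_cons, hw'.2.1]
        exact ⟨by simp, hw'.1⟩
      · rw [List.map_cons, List.mem_cons, hw'.2.1, Finset.mem_erase]
        by_cases hxa : x = a
        · simp [hxa, ha]
        · simp [hxa]
    have finish : ∀ τ : Bool, ∀ h : (a, τ) :: w ∈ (sortedWords V).filter
        (fun l => ¬ IsConventionalWord o l),
        (⟨(hd ((a, τ) :: w)).1, tl ((a, τ) :: w)⟩ : Σ _ : α, List (α × Bool)) = ⟨a, w⟩ := by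
      intro τ h
      have := heq _ h
      rw [List.cons.injEq] at this
      rw [← this.1, ← this.2]
    -- The type put in front keeps the word sorted: `o` is smaller than every label, and any other
    -- first letter starts a new run.
    by_cases hao : a = o
    · subst hao
      refine ⟨(a, false) :: w, ?_, finish _ ?_⟩ <;>
      · rw [Finset.mem_filter]
        refine ⟨hmemV _ (hw'.2.2.cons fun x hx _ => ?_), ?_⟩
        · have := label_mem_of_mem_sortedWords hw (List.mem_of_mem_head? hx)
          rw [Finset.mem_erase] at this
          exact lt_of_le_of_ne (hV _ this.2) (Ne.symm this.1)
        · rintro (h | ⟨x, y, v, h, hx, -⟩)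
          · simp at h
          · rw [List.cons.injEq] at h
            rw [← h.1] at hx
            exact hx rfl
    · rcases w with _ | ⟨b, v⟩
      · have := (hw'.2.1 o).2 (Finset.mem_erase.2 ⟨Ne.symm hao, ho⟩)
        simp at this
      · refine ⟨(a, !b.2) :: b :: v, ?_, finish _ ?_⟩ <;>
        · rw [Finset.mem_filter]
          refine ⟨hmemV _ (hw'.2.2.cons fun x hx h => ?_), ?_⟩
          · simp only [List.head?_cons, Option.mem_def, Option.some.injEq] at hx
            rw [← hx] at h
            simp at h
          · rintro (h | ⟨x, y, v, h, hx, h2⟩)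
            · simp only [List.head?_cons, Option.some.injEq, Prod.mk.injEq] at h
              exact hao h.1
            · simp only [List.cons.injEq] at h
              rw [← h.1, ← h.2.1] at h2
              simp at h2
  · intro l hl
    conv_lhs => rw [heq l hl]
    refine hF _ _ (ho1 l hl) fun h => ?_
    have := ((mem_sortedWords.1 (htl l hl)).2.1 o).2 (Finset.mem_erase.2 ⟨Ne.symm h, ho⟩)
    obtain ⟨x, hx, hxo⟩ := List.mem_map.1 this
    exact ⟨x, hx, hxo ▸ lt_of_le_of_ne (hV _ (hmem l hl)) (Ne.symm h)⟩

open scoped Classical in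
theorem sum_isConventionalWord_pow_oddAnchorCount (t : ℚ) {V : Finset α} {o : α}
    (ho : o ∈ V) (hV : ∀ x ∈ V, o ≤ x) :
    ∑ l ∈ (sortedWords V).filter (fun l => IsConventionalWord o l), t ^ oddAnchorCount false l =
      oddAnchorSum t V.card - V.card * oddAnchorSum t (V.card - 1) := by
  rw [eq_sub_iff_add_eq, ← sum_sortedWords_pow_oddAnchorCount t false V,
    ← Finset.sum_filter_add_sum_filter_not (sortedWords V) (fun l => IsConventionalWord o l)]
  congr 1
  rw [sum_not_isConventionalWord ho hV]
  · simp only [sum_sortedWords_pow_oddAnchorCount]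
    rw [Finset.sum_congr rfl fun a ha => by rw [Finset.card_erase_of_mem ha]]
    simp
  · intro a w h1 h2
    rw [oddAnchorCount]
    -- A leading recessive `o` agrees with the reference type `false` and passes it on; any other
    -- leading letter is no anchor, since a smaller label follows.
    by_cases ha : a.1 = o
    · rw [h1 ha, if_pos rfl, zero_add, ite_self]
    · obtain ⟨x, hx, hxa⟩ := h2 ha
      rw [if_neg fun h => lt_asymm hxa (h x hx)]

end SortedWords

/-! ### Normal forms: sorting the runs of a construction. -/

section SortingWords

variable {α : Type*} [LinearOrder α]

/-- Insert a letter into a sorted word, moving it past smaller letters of the same type. -/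
def insertLetter (a : α × Bool) : List (α × Bool) → List (α × Bool)
  | [] => [a]
  | b :: l => if a.2 = b.2 ∧ b.1 < a.1 then b :: insertLetter a l else a :: b :: l

/-- Sort the maximal runs of letters of the same type. -/
def sortWord : List (α × Bool) → List (α × Bool)
  | [] => []
  | a :: l => insertLetter a (sortWord l)

theorem insertLetter_perm (a : α × Bool) (l : List (α × Bool)) :
    (insertLetter a l).Perm (a :: l) := by
  induction l with
  | nil => exact List.Perm.refl _
  | cons b l ih =>
    rw [insertLetter]
    split_ifs
    · exact (ih.cons b).trans (List.Perm.swap a b l)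
    · exact List.Perm.refl _

theorem sortWord_perm (l : List (α × Bool)) : (sortWord l).Perm l := by
  induction l with
  | nil => exact List.Perm.refl _
  | cons a l ih => exact (insertLetter_perm a _).trans (ih.cons a)

theorem map_snd_insertLetter (a : α × Bool) (l : List (α × Bool)) :
    (insertLetter a l).map Prod.snd = a.2 :: l.map Prod.snd := by
  induction l with
  | nil => rfl
  | cons b l ih =>
    rw [insertLetter]
    split_ifs with h
    · rw [List.map_cons, ih, List.map_cons, h.1]
    · rfl

theorem map_snd_sortWord (l : List (α × Bool)) :
    (sortWord l).map Prod.snd = l.map Prod.snd := by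
  induction l with
  | nil => rfl
  | cons a l ih => rw [sortWord, map_snd_insertLetter, ih, List.map_cons]

theorem head?_insertLetter (a : α × Bool) (l : List (α × Bool)) :
    (insertLetter a l).head? = some a ∨ (insertLetter a l).head? = l.head? := by
  rcases l with _ | ⟨b, l⟩
  · exact Or.inl rfl
  · rw [insertLetter]
    split_ifs <;> simp

theorem IsSortedWord.insertLetter {a : α × Bool} {l : List (α × Bool)} (h : IsSortedWord l)
    (ha : a.1 ∉ l.map Prod.fst) : IsSortedWord (insertLetter a l) := by
  induction l with
  | nil => exact List.isChain_singleton a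
  | cons b l ih =>
    simp only [List.map_cons, List.mem_cons, not_or] at ha
    rw [_root_.insertLetter]
    unfold IsSortedWord at *
    split_ifs with hab
    · refine (ih h.tail ha.2).cons fun y hy => ?_
      rcases head?_insertLetter a l with h1 | h1
      · rw [h1] at hy
        obtain rfl : a = y := Option.some.inj hy
        exact fun _ => hab.2
      · rw [h1] at hy
        exact (List.isChain_cons.1 h).1 y hy
    · refine h.cons fun y hy hay => ?_
      obtain rfl : b = y := Option.some.inj hy
      exact lt_of_le_of_ne (not_lt.1 fun hlt => hab ⟨hay, hlt⟩) ha.1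

theorem isSortedWord_sortWord {l : List (α × Bool)} (h : (l.map Prod.fst).Nodup) :
    IsSortedWord (sortWord l) := by
  induction l with
  | nil => exact List.isChain_nil
  | cons a l ih =>
    rw [List.map_cons, List.nodup_cons] at h
    refine (ih h.2).insertLetter ?_
    rw [((sortWord_perm l).map Prod.fst).mem_iff]
    exact h.1

theorem oddAnchorCount_cons_congr {l l' : List (α × Bool)} (hp : l.Perm l')
    (h : ∀ τ, oddAnchorCount τ l = oddAnchorCount τ l') (τ : Bool) (a : α × Bool) :
    oddAnchorCount τ (a :: l) = oddAnchorCount τ (a :: l') := by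
  rw [oddAnchorCount, oddAnchorCount, h, h]
  exact if_congr (forall_congr' fun b => by rw [hp.mem_iff]) rfl rfl

/-- The larger label is no anchor when it comes first. When it comes second and is an anchor, so is
the smaller label of the same type before it, so it is not odd and leaves the reference type
unchanged. -/
theorem oddAnchorCount_swap (τ : Bool) {a b : α × Bool} (hab : a.2 = b.2) (hlt : b.1 < a.1)
    (l : List (α × Bool)) : oddAnchorCount τ (b :: a :: l) = oddAnchorCount τ (a :: b :: l) := by
  simp only [oddAnchorCount, List.forall_mem_cons]
  rw [if_neg (fun h : a.1 < b.1 ∧ _ => lt_asymm hlt h.1)]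
  simp only [hlt, true_and, hab, if_true]
  by_cases h1 : ∀ x ∈ l, b.1 < x.1
  · rw [if_pos h1, if_pos h1, zero_add, ite_self]
  · rw [if_neg h1, if_neg h1, if_neg fun h2 => h1 fun x hx => hlt.trans (h2 x hx)]

theorem oddAnchorCount_insertLetter (τ : Bool) (a : α × Bool) (l : List (α × Bool)) :
    oddAnchorCount τ (insertLetter a l) = oddAnchorCount τ (a :: l) := by
  induction l generalizing τ with
  | nil => rfl
  | cons b l ih =>
    rw [insertLetter]
    split_ifs with h
    · rw [oddAnchorCount_cons_congr (insertLetter_perm a l) ih, oddAnchorCount_swap τ h.1 h.2]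
    · rfl

theorem oddAnchorCount_sortWord (τ : Bool) (l : List (α × Bool)) :
    oddAnchorCount τ (sortWord l) = oddAnchorCount τ l := by
  induction l generalizing τ with
  | nil => rfl
  | cons a l ih =>
    rw [sortWord, oddAnchorCount_insertLetter, oddAnchorCount_cons_congr (sortWord_perm l) ih]

/-- The word is a construction of the graph `G` induced on its labels. -/
def Constructs {α : Type*} (l : List (α × Bool)) (G : SimpleGraph α) : Prop :=
  l.Pairwise fun a b => G.Adj a.1 b.1 ↔ b.2 = true

/-- Only letters of equal type are exchanged, and their mutual adjacency is given by that common
type in either order. -/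
theorem Constructs.insertLetter {G : SimpleGraph α} {a : α × Bool} {l : List (α × Bool)}
    (h : Constructs (a :: l) G) : Constructs (insertLetter a l) G := by
  induction l with
  | nil => exact h
  | cons b l ih =>
    rw [_root_.insertLetter]
    split_ifs with hab
    · unfold Constructs at *
      simp only [List.pairwise_cons, List.mem_cons, forall_eq_or_imp] at h ih ⊢
      refine ⟨fun x hx => ?_, ih ⟨h.1.2, h.2.2⟩⟩
      rw [(insertLetter_perm a l).mem_iff, List.mem_cons] at hx
      rcases hx with rfl | hx
      · rw [G.adj_comm, h.1.1, hab.1]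
      · exact h.2.1 x hx
    · exact h

theorem Constructs.sortWord {G : SimpleGraph α} {l : List (α × Bool)} (h : Constructs l G) :
    Constructs (sortWord l) G := by
  induction l with
  | nil => exact h
  | cons a l ih =>
    refine Constructs.insertLetter ?_
    unfold Constructs at *
    rw [List.pairwise_cons] at h ⊢
    exact ⟨fun x hx => h.1 x ((sortWord_perm l).mem_iff.1 hx), ih h.2⟩

/-- The type of the first vertex does not matter. -/
theorem Constructs.change_head {α : Type*} {G : SimpleGraph α} {a a' : α × Bool} {l : List (α × Bool)}
    (h : Constructs (a :: l) G) (ha : a'.1 = a.1) : Constructs (a' :: l) G := by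
  unfold Constructs at *
  rw [List.pairwise_cons] at h ⊢
  rw [ha]
  exact h

/-- Some two vertices `x`, `y` have the same adjacency to `o`, but not to each other. This says that
`o` does not belong to the first block of the construction. -/
def IsLateVertex {α : Type*} (G : SimpleGraph α) (o : α) : Prop :=
  ∃ x y, x ≠ o ∧ y ≠ o ∧ x ≠ y ∧ (G.Adj o x ↔ G.Adj o y) ∧ ¬(G.Adj x y ↔ G.Adj o x)

/-- If `p` precedes `q`, then `q` is joined to `p` and to the first vertex by the same rule, its own
type. So two vertices that look alike from the first vertex are adjacent exactly when they are
adjacent to it. -/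
theorem Constructs.not_isLateVertex {α : Type*} {G : SimpleGraph α} {a b : α × Bool} {l : List (α × Bool)}
    (h : Constructs (a :: b :: l) G) (hl : ∀ x, x ∈ (a :: b :: l).map Prod.fst) :
    ¬ IsLateVertex G a.1 := by
  rintro ⟨x, y, hx, hy, hxy, h1, h2⟩
  unfold Constructs at h
  have main : ∀ p q : α × Bool, [p, q].Sublist (b :: l) → (G.Adj a.1 p.1 ↔ G.Adj a.1 q.1) →
      (G.Adj p.1 q.1 ↔ G.Adj a.1 q.1) := by
    intro p q hpq _
    have h3 := h.sublist (hpq.cons_cons a)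
    simp only [List.pairwise_cons, List.mem_cons, List.not_mem_nil, or_false, forall_eq_or_imp,
      forall_eq] at h3
    rw [h3.2.1, h3.1.2]
  have mem : ∀ z, z ≠ a.1 → ∃ p ∈ b :: l, p.1 = z := by
    intro z hz
    have := hl z
    rw [List.map_cons, List.mem_cons] at this
    rcases this with h | h
    · exact absurd h hz
    · exact List.mem_map.1 h
  obtain ⟨p, hp, rfl⟩ := mem x hx
  obtain ⟨q, hq, rfl⟩ := mem y hy
  have hsub : [p, q].Sublist (b :: l) ∨ [q, p].Sublist (b :: l) := by
    obtain ⟨u, v, huv⟩ := List.append_of_mem hp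
    rw [huv, List.mem_append, List.mem_cons] at hq
    rw [huv]
    rcases hq with hq | rfl | hq
    · right
      exact (List.singleton_sublist.2 hq).append (List.singleton_sublist.2 List.mem_cons_self)
    · exact absurd rfl hxy
    · left
      exact (List.Sublist.cons_cons p (List.singleton_sublist.2 hq)).trans
        (List.sublist_append_right u _)
  rcases hsub with hs | hs
  · exact h2 ((main p q hs h1).trans h1.symm)
  · exact h2 (by rw [G.adj_comm]; exact main q p hs h1.symm)

/-- Every construction of a graph with least vertex `o` can be brought into a sorted conventional
form, and this preserves the number of odd anchors if the convention about `o` was followed. -/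
theorem exists_sorted_conventional_word [Fintype α] {G : SimpleGraph α} {o : α}
    (ho : ∀ x, o ≤ x) {l : List (α × Bool)} (hn : (l.map Prod.fst).Nodup)
    (hl : ∀ x, x ∈ l.map Prod.fst) (hG : Constructs l G) :
    ∃ l' ∈ sortedWords (Finset.univ : Finset α), IsConventionalWord o l' ∧ Constructs l' G ∧
      ((l.head? = some (o, true) ∨ IsLateVertex G o) →
        oddAnchorCount false l' = oddAnchorCount false l) := by
  have mem_of_perm : ∀ l' : List (α × Bool), (l'.map Prod.fst).Perm (l.map Prod.fst) →
      IsSortedWord l' → l' ∈ sortedWords (Finset.univ : Finset α) := by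
    intro l' hp hs
    rw [mem_sortedWords]
    exact ⟨hp.nodup_iff.2 hn, fun x => by simp [hp.mem_iff, hl], hs⟩
  have sorted_cons : ∀ (τ : Bool) (v : List (α × Bool)), o ∉ v.map Prod.fst → IsSortedWord v →
      IsSortedWord ((o, τ) :: v) := by
    intro τ v hv hs
    refine hs.cons fun y hy _ => lt_of_le_of_ne (ho _) ?_
    rintro rfl
    exact hv (List.mem_map_of_mem (List.mem_of_mem_head? hy))
  rcases l with _ | ⟨a, v⟩
  · simpa using hl o
  · have hn' := hn
    rw [List.map_cons, List.nodup_cons] at hn'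
    by_cases hao : a.1 = o
    · refine ⟨(o, true) :: sortWord v, ?_, Or.inl rfl, ?_, ?_⟩
      · refine mem_of_perm _ ?_ (sorted_cons _ _ ?_ (isSortedWord_sortWord hn'.2))
        · rw [List.map_cons, List.map_cons, hao]
          exact ((sortWord_perm v).map _).cons o
        · rw [((sortWord_perm v).map _).mem_iff, ← hao]
          exact hn'.1
      · have h1 : Constructs (a :: sortWord v) G := by
          have h2 := (List.pairwise_cons.1 hG).2
          refine List.pairwise_cons.2 ⟨fun x hx => ?_, Constructs.sortWord h2⟩
          exact (List.pairwise_cons.1 hG).1 x ((sortWord_perm v).mem_iff.1 hx)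
        exact h1.change_head hao.symm
      · intro h
        have ha' : a = (o, true) := by
          rcases h with h | h
          · rwa [List.head?_cons, Option.some.injEq] at h
          · exfalso
            rcases v with _ | ⟨b, w⟩
            · obtain ⟨x, -, hx, -⟩ := h
              have := hl x
              simp only [List.map_cons, List.map_nil, List.mem_singleton] at this
              exact hx (this.trans hao)
            · exact hG.not_isLateVertex hl (hao.symm ▸ h)
        rw [ha']
        exact oddAnchorCount_cons_congr (sortWord_perm v) (fun τ => oddAnchorCount_sortWord τ v) _ _
    · rcases v with _ | ⟨b, w⟩
      · have := hl o
        simp only [List.map_cons, List.map_nil, List.mem_singleton] at this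
        exact absurd this.symm hao
      -- The first type is made equal to the second before sorting. The graph does not see it, and
      -- neither does the count, because `o` comes later and the first letter is no anchor.
      · have hG1 : Constructs ((a.1, b.2) :: b :: w) G := hG.change_head rfl
        have hodd : oddAnchorCount false ((a.1, b.2) :: b :: w) =
            oddAnchorCount false (a :: b :: w) := by
          have : ¬ ∀ x ∈ b :: w, a.1 < x.1 := by
            intro h
            have := hl o
            rw [List.map_cons, List.mem_cons] at this
            rcases this with h1 | h1
            · exact hao h1.symm
            · obtain ⟨x, hx, hxo⟩ := List.mem_map.1 h1
              exact absurd (h x hx) (not_lt.2 (hxo ▸ ho _))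
          exact (if_neg this).trans (if_neg this).symm
        have hp := (sortWord_perm ((a.1, b.2) :: b :: w)).map Prod.fst
        have hs : IsSortedWord (sortWord ((a.1, b.2) :: b :: w)) := isSortedWord_sortWord hn
        have hG2 := hG1.sortWord
        have htypes := map_snd_sortWord ((a.1, b.2) :: b :: w)
        have hcount := oddAnchorCount_sortWord false ((a.1, b.2) :: b :: w)
        generalize sortWord ((a.1, b.2) :: b :: w) = l₂ at *
        rcases l₂ with _ | ⟨a', _ | ⟨b', w'⟩⟩
        · simp at htypes
        · simp at htypes
        -- Sorting may bring `o` to the front. Then `o` is not late, and the original word did not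
        -- begin with `o`, so nothing is claimed about the count.
        · by_cases ha' : a'.1 = o
          · have hl2 : ∀ x, x ∈ (a' :: b' :: w').map Prod.fst := fun x => hp.mem_iff.2 (hl x)
            refine ⟨(o, true) :: b' :: w', ?_, Or.inl rfl, hG2.change_head ha'.symm, ?_⟩
            · refine mem_of_perm _ ?_ (sorted_cons _ _ ?_ hs.tail)
              · rw [List.map_cons, ← ha']
                exact hp
              · have := hp.nodup_iff.2 hn
                rw [List.map_cons, List.nodup_cons, ha'] at this
                exact this.1
            · rintro (h | h)
              · rw [List.head?_cons, Option.some.injEq] at h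
                exact absurd (by rw [h]) hao
              · exact absurd (ha'.symm ▸ h) (hG2.not_isLateVertex hl2)
          · refine ⟨a' :: b' :: w', mem_of_perm _ hp hs, Or.inr ⟨a', b', w', rfl, ha', ?_⟩, hG2,
              fun _ => hcount.trans hodd⟩
            simp only [List.map_cons, List.cons.injEq] at htypes
            rw [htypes.1, htypes.2.1]

end SortingWords

/-! ### Odd anchors by position and by recursion on the word. -/

section OddAnchorPositions

variable {α : Type*} [LinearOrder α]

/-- The letter at position `i` has a smaller label than all later letters. -/
def IsAnchorAt {k : ℕ} (f : Fin k → α × Bool) (i : Fin k) : Prop :=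
  ∀ j, i < j → (f i).1 < (f j).1

/-- The letter at position `i` is an anchor of a type different from that of the previous anchor,
where the first anchor is compared with `τ`. -/
def IsOddAnchorAt {k : ℕ} (τ : Bool) (f : Fin k → α × Bool) (i : Fin k) : Prop :=
  IsAnchorAt f i ∧ (((∀ l, l < i → ¬ IsAnchorAt f l) ∧ (f i).2 ≠ τ) ∨
    ∃ l, IsAnchorAt f l ∧ l < i ∧ (∀ m, l < m → m < i → ¬ IsAnchorAt f m) ∧ (f l).2 ≠ (f i).2)

theorem isAnchorAt_succ {k : ℕ} (f : Fin (k + 1) → α × Bool) (i : Fin k) :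
    IsAnchorAt f i.succ ↔ IsAnchorAt (fun j => f j.succ) i := by
  unfold IsAnchorAt
  rw [Fin.forall_fin_succ]
  simp

theorem isAnchorAt_zero {k : ℕ} (f : Fin (k + 1) → α × Bool) :
    IsAnchorAt f 0 ↔ ∀ b ∈ List.ofFn (fun j : Fin k => f j.succ), (f 0).1 < b.1 := by
  unfold IsAnchorAt
  rw [Fin.forall_fin_succ, List.forall_mem_ofFn_iff]
  simp

theorem isOddAnchorAt_zero {k : ℕ} (τ : Bool) (f : Fin (k + 1) → α × Bool) :
    IsOddAnchorAt τ f 0 ↔ IsAnchorAt f 0 ∧ (f 0).2 ≠ τ := by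
  simp [IsOddAnchorAt]

/-- The head is the previous anchor of the first anchor of the tail, so its type becomes the
reference. -/
theorem isOddAnchorAt_succ_of_isAnchorAt {k : ℕ} (τ : Bool) (f : Fin (k + 1) → α × Bool)
    (h : IsAnchorAt f 0) (i : Fin k) :
    IsOddAnchorAt τ f i.succ ↔ IsOddAnchorAt (f 0).2 (fun j => f j.succ) i := by
  unfold IsOddAnchorAt
  rw [Fin.exists_fin_succ]
  simp only [Fin.forall_fin_succ, isAnchorAt_succ, Fin.succ_lt_succ_iff, h, Fin.succ_pos,
    lt_self_iff_false, Fin.not_lt_zero, true_and, not_true_eq_false, imp_false,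
    not_false_eq_true, false_and, false_or, true_imp_iff]
  rw [ne_comm]

theorem isOddAnchorAt_succ_of_not_isAnchorAt {k : ℕ} (τ : Bool) (f : Fin (k + 1) → α × Bool)
    (h : ¬ IsAnchorAt f 0) (i : Fin k) :
    IsOddAnchorAt τ f i.succ ↔ IsOddAnchorAt τ (fun j => f j.succ) i := by
  unfold IsOddAnchorAt
  rw [Fin.exists_fin_succ]
  simp only [Fin.forall_fin_succ, isAnchorAt_succ, Fin.succ_lt_succ_iff, h, Fin.succ_pos,
    Fin.not_lt_zero, true_and, not_false_eq_true, implies_true,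
    false_and, false_or]

open scoped Classical in
theorem card_isOddAnchorAt {k : ℕ} (τ : Bool) (f : Fin k → α × Bool) :
    (Finset.univ.filter (IsOddAnchorAt τ f)).card = oddAnchorCount τ (List.ofFn f) := by
  induction k generalizing τ with
  | zero => simp [oddAnchorCount]
  | succ k ih =>
    rw [Fin.card_filter_univ_succ, List.ofFn_succ, oddAnchorCount, isOddAnchorAt_zero]
    by_cases h : IsAnchorAt f 0
    · rw [if_pos ((isAnchorAt_zero f).1 h), ← ih]
      simp only [isOddAnchorAt_succ_of_isAnchorAt τ f h, h, true_and]
      by_cases h2 : (f 0).2 = τ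
      · simp [h2]
      · simp [h2, add_comm]
    · rw [if_neg (fun h' => h ((isAnchorAt_zero f).2 h')), ← ih]
      simp only [isOddAnchorAt_succ_of_not_isAnchorAt τ f h, h, false_and,
        if_false]

end OddAnchorPositions

/-! ### Constructions as words, and uniqueness of the canonical construction. -/

namespace ThresholdConstruction

variable {n : ℕ}

/-- The word of a construction: the vertices with their types, in the order of addition. -/
def word (c : ThresholdConstruction n) : List (Fin n × Bool) :=
  List.ofFn fun k => (c.vertex k, c.dominant k)

/-- The reference type `false` encodes that the first anchor is odd exactly when it is dominant. -/
theorem numOddAnchors_eq (c : ThresholdConstruction n) :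
    c.numOddAnchors = oddAnchorCount false c.word := by
  classical
  rw [word, ← card_isOddAnchorAt, numOddAnchors, ← Set.ncard_coe_finset]
  congr 1
  ext k
  simp only [Finset.coe_filter, Finset.mem_univ, true_and, Set.mem_ofPred_eq, IsOddAnchor,
    IsOddAnchorAt, IsPreviousAnchor]
  refine and_congr_right fun hk => or_congr (and_congr Iff.rfl (by simp)) ?_
  refine exists_congr fun l => ?_
  constructor
  · rintro ⟨⟨h1, -, h2, h3⟩, h4⟩
    exact ⟨h1, h2, h3, h4⟩
  · rintro ⟨h1, h2, h3, h4⟩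
    exact ⟨⟨h1, hk, h2, h3⟩, h4⟩

theorem map_fst_word (c : ThresholdConstruction n) :
    c.word.map Prod.fst = List.ofFn c.vertex := by
  rw [word, List.map_ofFn]
  rfl

theorem nodup_map_fst_word (c : ThresholdConstruction n) : (c.word.map Prod.fst).Nodup := by
  rw [map_fst_word, List.nodup_ofFn]
  exact c.vertex.injective

theorem mem_map_fst_word (c : ThresholdConstruction n) (x : Fin n) :
    x ∈ c.word.map Prod.fst := by
  rw [map_fst_word, List.mem_ofFn]
  exact c.vertex.surjective x

theorem exists_word_eq {l : List (Fin n × Bool)} (hn : (l.map Prod.fst).Nodup)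
    (hl : ∀ x, x ∈ l.map Prod.fst) : ∃ c : ThresholdConstruction n, c.word = l := by
  have hlen : l.length = n := by
    have h1 : (l.map Prod.fst).toFinset = Finset.univ := by
      ext x
      rw [List.mem_toFinset]
      simp [hl x]
    have h2 := List.toFinset_card_of_nodup hn
    rw [h1] at h2
    simpa using h2.symm
  obtain ⟨f, rfl⟩ : ∃ f : Fin n → Fin n × Bool, List.ofFn f = l := by
    exact ⟨fun i => l.get (i.cast hlen.symm), List.ext_getElem (by simp [hlen]) (by simp)⟩
  rw [List.map_ofFn, List.nodup_ofFn] at hn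
  refine ⟨⟨Equiv.ofBijective _ (Finite.injective_iff_bijective.1 hn), fun k => (f k).2⟩, ?_⟩
  rfl

theorem graph_adj (c : ThresholdConstruction n) {i j : Fin n} (hij : i < j) :
    c.graph.Adj (c.vertex i) (c.vertex j) ↔ c.dominant j = true := by
  simp [graph, hij, hij.ne, hij.not_gt]

theorem constructs_word_iff (c : ThresholdConstruction n) (G : SimpleGraph (Fin n)) :
    Constructs c.word G ↔ c.graph = G := by
  unfold Constructs
  rw [word, List.pairwise_ofFn]
  constructor
  · intro h
    ext x y
    obtain ⟨i, rfl⟩ := c.vertex.surjective x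
    obtain ⟨j, rfl⟩ := c.vertex.surjective y
    rcases lt_trichotomy i j with hij | rfl | hij
    · rw [c.graph_adj hij, h hij]
    · simp
    · rw [SimpleGraph.adj_comm, c.graph_adj hij, SimpleGraph.adj_comm, h hij]
  · rintro rfl i j hij
    exact c.graph_adj hij

theorem isSortedWord_word_iff (c : ThresholdConstruction n) :
    IsSortedWord c.word ↔ ∀ i (h : i + 1 < n),
      c.dominant ⟨i, Nat.lt_of_succ_lt h⟩ = c.dominant ⟨i + 1, h⟩ →
        c.vertex ⟨i, Nat.lt_of_succ_lt h⟩ < c.vertex ⟨i + 1, h⟩ := by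
  unfold IsSortedWord
  rw [word, List.isChain_ofFn]

/-- The sorted constructions that start with the dominant vertex `1`, or with two vertices of the
same type, the first of which is not `1`. -/
structure IsCanonical {m : ℕ} (c : ThresholdConstruction (m + 1)) : Prop where
  sorted : ∀ i (h : i + 1 < m + 1),
    c.dominant ⟨i, Nat.lt_of_succ_lt h⟩ = c.dominant ⟨i + 1, h⟩ →
      c.vertex ⟨i, Nat.lt_of_succ_lt h⟩ < c.vertex ⟨i + 1, h⟩
  conventional : (c.vertex 0 = 0 ∧ c.dominant 0 = true) ∨
    (c.vertex 0 ≠ 0 ∧ ∀ j : Fin (m + 1), j.val = 1 → c.dominant 0 = c.dominant j)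

variable {m : ℕ}

theorem isCanonical_of_isConventionalWord {c : ThresholdConstruction (m + 1)}
    (hs : IsSortedWord c.word) (hc : IsConventionalWord 0 c.word) : c.IsCanonical := by
  refine ⟨(isSortedWord_word_iff c).1 hs, ?_⟩
  rcases hc with h | ⟨a, b, w, h, ha, hab⟩
  · left
    rw [word, List.ofFn_succ, List.head?_cons, Option.some.injEq, Prod.mk.injEq] at h
    exact h
  · right
    rw [word, List.ofFn_succ, List.cons.injEq] at h
    obtain ⟨rfl, h⟩ := h
    refine ⟨ha, fun j hj => ?_⟩
    obtain ⟨k, rfl⟩ : ∃ k, m = k + 1 := ⟨m - 1, by omega⟩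
    rw [List.ofFn_succ, List.cons.injEq] at h
    obtain ⟨rfl, -⟩ := h
    have : j = Fin.succ 0 := Fin.ext hj
    rw [this]
    exact hab

/-- If vertex `1` is not first, its predecessor has a larger label and hence, by sortedness, another
type. That predecessor is not the first vertex, because the first two types agree. -/
theorem IsCanonical.followsConvention {c : ThresholdConstruction (m + 1)} (hc : c.IsCanonical) :
    c.FollowsConvention := by
  intro p hp
  have hp' : c.vertex p = 0 := Fin.ext hp
  by_cases hp0 : p.val = 0
  · left
    have : p = 0 := Fin.ext hp0
    subst this
    rcases hc.conventional with h | h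
    · exact ⟨rfl, h.2⟩
    · exact absurd hp' h.1
  · right
    obtain ⟨q, hq⟩ : ∃ q, p.val = q + 1 := ⟨p.val - 1, by omega⟩
    have hlt : q + 1 < m + 1 := hq ▸ p.2
    obtain rfl : p = ⟨q + 1, hlt⟩ := Fin.ext hq
    have hne : c.dominant ⟨q, Nat.lt_of_succ_lt hlt⟩ ≠ c.dominant ⟨q + 1, hlt⟩ := by
      intro h
      have := hc.sorted q hlt h
      rw [hp'] at this
      exact Fin.not_lt_zero _ this
    refine ⟨⟨q, Nat.lt_of_succ_lt hlt⟩, ?_, Fin.mk_lt_mk.2 (Nat.lt_succ_self q), hne⟩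
    rcases Nat.eq_zero_or_pos q with rfl | hq0
    · rcases hc.conventional with h | h
      · have : (0 : Fin (m + 1)) = ⟨0 + 1, hlt⟩ := c.vertex.injective (h.1.trans hp'.symm)
        simp [Fin.ext_iff] at this
      · exact absurd (h.2 _ rfl) hne
    · exact hq0

/-- This turns the convention into a property of the graph. The witnesses for lateness are the first
vertex and the vertex of differing type: vertex `1` sees both according to its own type, while they
see each other according to the other type. -/
theorem FollowsConvention.head_or_isLateVertex {c : ThresholdConstruction (m + 1)}
    (hc : c.FollowsConvention) :
    c.word.head? = some (0, true) ∨ IsLateVertex c.graph 0 := by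
  obtain ⟨p, hp⟩ := c.vertex.surjective 0
  rcases hc p (by rw [hp]; rfl) with ⟨h1, h2⟩ | ⟨i, hi0, hip, hne⟩
  · left
    have : p = 0 := Fin.ext h1
    subst this
    rw [word, List.ofFn_succ, List.head?_cons, hp, h2]
  · right
    have hi : (0 : Fin (m + 1)) < i := hi0
    rw [← hp]
    refine ⟨c.vertex i, c.vertex 0, c.vertex.injective.ne hip.ne,
      c.vertex.injective.ne (hi.trans hip).ne, c.vertex.injective.ne hi.ne', ?_, ?_⟩
    · rw [c.graph.adj_comm, c.graph_adj hip, c.graph.adj_comm, c.graph_adj (hi.trans hip)]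
    · rw [c.graph.adj_comm, c.graph_adj hi, c.graph.adj_comm, c.graph_adj hip,
        ← Bool.eq_iff_iff]
      exact hne

/-- Vertices with the same neighbours apart from each other lie in one run: an intermediate vertex
reveals its type to be that of `j`, and the type of `i` is compared through the first vertex or, if
`i` is first, through the convention. Labels increase along the run. If `i` carries the least label
there is nothing to prove. -/
theorem IsCanonical.vertex_lt {c : ThresholdConstruction (m + 1)} (hc : c.IsCanonical)
    {i j : Fin (m + 1)} (hij : i < j)
    (h : ∀ z, z ≠ c.vertex i → z ≠ c.vertex j →
      (c.graph.Adj z (c.vertex i) ↔ c.graph.Adj z (c.vertex j))) : c.vertex i < c.vertex j := by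
  have hmid : ∀ k, i < k → k < j → c.dominant k = c.dominant j := by
    intro k hik hkj
    have := h (c.vertex k) (c.vertex.injective.ne hik.ne') (c.vertex.injective.ne hkj.ne)
    rw [c.graph.adj_comm, c.graph_adj hik, c.graph_adj hkj] at this
    exact Bool.eq_iff_iff.2 this
  by_cases h0 : c.vertex i = 0
  · rw [h0]
    refine Fin.pos_of_ne_zero ?_
    rw [← h0]
    exact c.vertex.injective.ne hij.ne'
  have hi : c.dominant i = c.dominant j := by
    by_cases hi0 : i = 0
    · subst hi0
      rcases hc.conventional with h1 | ⟨-, h1⟩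
      · exact absurd h1.1 h0
      · have hj : 0 < j.val := hij
        have hm : 1 < m + 1 := by omega
        rw [h1 ⟨1, hm⟩ rfl]
        by_cases hj1 : j.val = 1
        · congr 1
          exact Fin.ext hj1.symm
        · exact hmid _ (Fin.mk_lt_mk.2 Nat.one_pos) (Fin.lt_def.2 (by simp only; omega))
    · have hi0' := Fin.pos_of_ne_zero hi0
      have := h (c.vertex 0) (c.vertex.injective.ne hi0'.ne)
        (c.vertex.injective.ne (hi0'.trans hij).ne)
      rw [c.graph_adj hi0', c.graph_adj (hi0'.trans hij)] at this
      exact Bool.eq_iff_iff.2 this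
  have hall : ∀ k, i ≤ k → k ≤ j → c.dominant k = c.dominant j := by
    intro k hik hkj
    rcases hik.eq_or_lt with rfl | hik
    · exact hi
    · rcases hkj.eq_or_lt with rfl | hkj
      · rfl
      · exact hmid k hik hkj
  have step : ∀ d (hd : i.val + d + 1 ≤ j.val),
      c.vertex i < c.vertex ⟨i.val + d + 1, lt_of_le_of_lt hd j.2⟩ := by
    intro d
    induction d with
    | zero =>
      intro hd
      refine hc.sorted i.val (lt_of_le_of_lt hd j.2) ((hall _ ?_ ?_).trans (hall _ ?_ ?_).symm)
      · exact le_rfl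
      · exact hij.le
      · exact Fin.le_def.2 (by simp)
      · exact Fin.le_def.2 hd
    | succ d ih =>
      intro hd
      refine (ih (by omega)).trans (hc.sorted (i.val + d + 1) (lt_of_le_of_lt hd j.2)
        ((hall _ ?_ ?_).trans (hall _ ?_ ?_).symm)) <;>
      · rw [Fin.le_def]
        simp only
        omega
  have hij' : i.val < j.val := hij
  have := step (j.val - i.val - 1) (by omega)
  have hj : (⟨i.val + (j.val - i.val - 1) + 1, by omega⟩ : Fin (m + 1)) = j :=
    Fin.ext (by simp only; omega)
  rwa [hj] at this

/-- Two vertices added in different orders in two constructions of the same graph have the same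
neighbours. -/
theorem adj_iff_adj_of_order_reversed {c c' : ThresholdConstruction n} (h : c.graph = c'.graph)
    {x y : Fin n} (hxy : c.vertex.symm x < c.vertex.symm y)
    (hyx : c'.vertex.symm y < c'.vertex.symm x) {z : Fin n} (hzx : z ≠ x) (hzy : z ≠ y) :
    c.graph.Adj z x ↔ c.graph.Adj z y := by
  have adj : ∀ (c : ThresholdConstruction n) {u v : Fin n},
      c.vertex.symm u < c.vertex.symm v →
        (c.graph.Adj u v ↔ c.dominant (c.vertex.symm v) = true) := by
    intro c u v huv
    simpa using c.graph_adj huv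
  have h1 : (c.graph.Adj z x ↔ c.graph.Adj z y) ∨ (c.graph.Adj z y ↔ c.graph.Adj x y) := by
    rcases lt_trichotomy (c.vertex.symm z) (c.vertex.symm y) with hz | hz | hz
    · right
      rw [adj c hz, adj c hxy]
    · exact absurd (c.vertex.symm.injective hz) hzy
    · left
      rw [c.graph.adj_comm, adj c (hxy.trans hz), c.graph.adj_comm z, adj c hz]
  have h2 : (c.graph.Adj z x ↔ c.graph.Adj z y) ∨ (c.graph.Adj z x ↔ c.graph.Adj x y) := by
    rw [h]
    rcases lt_trichotomy (c'.vertex.symm z) (c'.vertex.symm x) with hz | hz | hz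
    · right
      rw [adj c' hz, c'.graph.adj_comm x, adj c' hyx]
    · exact absurd (c'.vertex.symm.injective hz) hzx
    · left
      rw [c'.graph.adj_comm, adj c' hz, c'.graph.adj_comm z, adj c' (hyx.trans hz)]
  -- In the remaining case both adjacencies of `z` agree with that of `x` and `y`, hence with each
  -- other.
  tauto

/-- Vertices in opposite orders would have the same neighbours, and then each construction would
force the opposite inequality between their labels. -/
theorem IsCanonical.symm_lt_of_graph_eq {c c' : ThresholdConstruction (m + 1)}
    (hc : c.IsCanonical) (hc' : c'.IsCanonical) (h : c.graph = c'.graph) {x y : Fin (m + 1)}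
    (hxy : c.vertex.symm x < c.vertex.symm y) : c'.vertex.symm x < c'.vertex.symm y := by
  by_contra hyx
  have hne : x ≠ y := fun h => hxy.ne (congrArg _ h)
  replace hyx : c'.vertex.symm y < c'.vertex.symm x :=
    lt_of_le_of_ne (not_lt.1 hyx) (c'.vertex.symm.injective.ne hne.symm)
  have twin : ∀ z, z ≠ x → z ≠ y → (c.graph.Adj z x ↔ c.graph.Adj z y) :=
    fun z hzx hzy => adj_iff_adj_of_order_reversed h hxy hyx hzx hzy
  have h1 := hc.vertex_lt hxy (by simpa using twin)
  have h2 := hc'.vertex_lt hyx (by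
    simp only [Equiv.apply_symm_apply, ← h]
    exact fun z hzy hzx => (twin z hzx hzy).symm)
  simp only [Equiv.apply_symm_apply] at h1 h2
  exact lt_asymm h1 h2

/-- Equal orders give equal permutations; the graph determines all types but the first, which the
convention fixes. -/
theorem IsCanonical.eq_of_graph_eq {c c' : ThresholdConstruction (m + 1)}
    (hc : c.IsCanonical) (hc' : c'.IsCanonical) (h : c.graph = c'.graph) : c = c' := by
  have hv : c.vertex = c'.vertex := by
    have hmono : StrictMono (fun i => c'.vertex.symm (c.vertex i)) := by
      intro i j hij
      exact hc.symm_lt_of_graph_eq hc' h (by simpa using hij)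
    -- A strictly monotone permutation of a finite chain is the identity.
    have hid : (fun i => c'.vertex.symm (c.vertex i)) = id := by
      refine (hmono.range_inj strictMono_id).1 ?_
      rw [Set.range_id]
      exact ((c.vertex.trans c'.vertex.symm).surjective).range_eq
    ext i
    have := congrFun hid i
    simp only [id, Equiv.symm_apply_eq] at this
    rw [this]
  have hpos : ∀ j, 0 < j → c.dominant j = c'.dominant j := by
    intro j hj
    rw [Bool.eq_iff_iff, ← c.graph_adj hj, h, hv, c'.graph_adj hj]
  have hd : c.dominant = c'.dominant := by
    ext j
    by_cases hj : j = 0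
    · subst hj
      rcases hc.conventional with h1 | h1 <;> rcases hc'.conventional with h2 | h2
      · rw [h1.2, h2.2]
      · exact absurd (hv ▸ h1.1) h2.1
      · exact absurd (hv ▸ h2.1) h1.1
      · rcases Nat.eq_zero_or_pos m with rfl | hm
        · exact absurd (Fin.ext (by omega)) h1.1
        · rw [h1.2 ⟨1, by omega⟩ rfl, h2.2 ⟨1, by omega⟩ rfl]
          exact hpos _ (Fin.mk_lt_mk.2 Nat.one_pos)
    · exact hpos j (Fin.pos_of_ne_zero hj)
  cases c
  cases c'
  simp only at hv hd
  rw [hv, hd]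

end ThresholdConstruction

/-! ### Comparison of coefficients. -/

section CharacteristicPolynomialCoefficients

open Polynomial

theorem eval_characteristicPolynomial_eq_oddAnchorSum (n m : ℕ) :
    (((characteristicPolynomial (thresholdArrangement n)).eval (2 * m + 1 : ℤ) : ℤ) : ℚ) =
      (-1) ^ n * (oddAnchorSum (-(2 * m + 1)) n - n * oddAnchorSum (-(2 * m + 1)) (n - 1)) := by
  rw [eval_characteristicPolynomial_thresholdArrangement, Int.cast_natCast,
    card_thresholdColorings, Finset.card_univ, Fintype.card_fin]
  refine numThresholdColorings_eq ?_ numSortedWordsNotEndingWith_succ ?_ ?_ n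
  · rw [numSortedWordsNotEndingWith]
  · rw [oddAnchorSum]
  · intro k
    rw [oddAnchorSum_succ]
    ring

/-- If the generating polynomial of a statistic has the values of `(-1)^n χ(-t)`, then the absolute
values of the coefficients of `χ` count the objects by this statistic. -/
theorem abs_coeff_characteristicPolynomial {β : Type*} (n : ℕ) (S : Finset β) (d : β → ℕ)
    (h : ∀ t : ℚ, ∑ b ∈ S, t ^ d b = oddAnchorSum t n - n * oddAnchorSum t (n - 1)) (j : ℕ) :
    |(characteristicPolynomial (thresholdArrangement n)).coeff j| =
      ((S.filter (fun b => d b = j)).card : ℤ) := by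
  have hpoly : characteristicPolynomial (thresholdArrangement n) =
      (-1) ^ n * (∑ b ∈ S, X ^ d b : ℤ[X]).comp (-X) := by
    refine Polynomial.eq_of_infinite_eval_eq _ _ ?_
    -- The point count provides the values at the positive odd integers, which are infinitely many
    -- and so determine the polynomial.
    refine Set.Infinite.mono (s := Set.range fun m : ℕ => (2 * m + 1 : ℤ)) ?_
      (Set.infinite_range_of_injective fun a b hab => by simpa using hab)
    rintro _ ⟨m, rfl⟩
    rw [Set.mem_ofPred_eq, ← Int.cast_inj (α := ℚ), eval_characteristicPolynomial_eq_oddAnchorSum,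
      ← h]
    simp [eval_finsetSum]
  have hsign : ∀ k : ℕ, |((-1 : ℤ)) ^ k| = 1 := fun k => by rw [abs_pow, abs_neg, abs_one, one_pow]
  have hC : ((-1) ^ n : ℤ[X]) = C ((-1) ^ n) := by simp
  have hX : (-X : ℤ[X]) = C (-1) * X := by simp
  rw [hpoly, hC, coeff_C_mul, hX, comp_C_mul_X_coeff, abs_mul, abs_mul, hsign, hsign, one_mul, mul_one,
    finsetSum_coeff]
  simp only [coeff_X_pow, Finset.sum_boole, eq_comm (a := j)]
  exact abs_of_nonneg (by positivity)

end CharacteristicPolynomialCoefficients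

/-! ### Canonical words as representatives of threshold graphs. -/

section CanonicalWords

open ThresholdConstruction

variable {m : ℕ}

open scoped Classical in
/-- The sorted words on `m + 1` labels that follow the convention about the least label. -/
noncomputable def canonicalWords (m : ℕ) : Finset (List (Fin (m + 1) × Bool)) :=
  (sortedWords Finset.univ).filter fun l => IsConventionalWord 0 l

open scoped Classical in
theorem mem_canonicalWords {l : List (Fin (m + 1) × Bool)} :
    l ∈ canonicalWords m ↔ l ∈ sortedWords Finset.univ ∧ IsConventionalWord 0 l := by
  rw [canonicalWords, Finset.mem_filter]

theorem exists_isCanonical_word_eq {l : List (Fin (m + 1) × Bool)} (hl : l ∈ canonicalWords m) :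
    ∃ c : ThresholdConstruction (m + 1), c.word = l ∧ c.IsCanonical := by
  rw [mem_canonicalWords, mem_sortedWords] at hl
  obtain ⟨⟨h1, h2, h3⟩, h4⟩ := hl
  obtain ⟨c, rfl⟩ := exists_word_eq h1 fun x => (h2 x).2 (Finset.mem_univ x)
  exact ⟨c, rfl, isCanonical_of_isConventionalWord h3 h4⟩

theorem eq_of_constructs {l l' : List (Fin (m + 1) × Bool)} (hl : l ∈ canonicalWords m)
    (hl' : l' ∈ canonicalWords m) {G : SimpleGraph (Fin (m + 1))} (h : Constructs l G)
    (h' : Constructs l' G) : l = l' := by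
  obtain ⟨c, rfl, hc⟩ := exists_isCanonical_word_eq hl
  obtain ⟨c', rfl, hc'⟩ := exists_isCanonical_word_eq hl'
  rw [constructs_word_iff] at h h'
  rw [hc.eq_of_graph_eq hc' (h.trans h'.symm)]

theorem exists_canonicalWord (c : ThresholdConstruction (m + 1)) :
    ∃ l ∈ canonicalWords m, Constructs l c.graph ∧
      (c.FollowsConvention → c.numOddAnchors = oddAnchorCount false l) := by
  obtain ⟨l, h1, h2, h3, h4⟩ := exists_sorted_conventional_word (o := 0) (fun x => Fin.zero_le x)
    c.nodup_map_fst_word c.mem_map_fst_word ((c.constructs_word_iff c.graph).2 rfl)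
  refine ⟨l, mem_canonicalWords.2 ⟨h1, h2⟩, h3, fun hc => ?_⟩
  rw [numOddAnchors_eq, h4 hc.head_or_isLateVertex]

/-- Any construction of `G` that follows the convention normalizes to a canonical word with the same
count, and uniqueness makes that word `l`. -/
theorem hasNumOddAnchors_of_constructs {l : List (Fin (m + 1) × Bool)} (hl : l ∈ canonicalWords m)
    {G : SimpleGraph (Fin (m + 1))} (h : Constructs l G) :
    HasNumOddAnchors G (oddAnchorCount false l) := by
  constructor
  · obtain ⟨c, rfl, hc⟩ := exists_isCanonical_word_eq hl
    exact ⟨c, (c.constructs_word_iff G).1 h, hc.followsConvention⟩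
  · rintro c rfl hc
    obtain ⟨l', hl', h', hodd⟩ := exists_canonicalWord c
    rw [hodd hc, eq_of_constructs hl hl' h h']

theorem hasNumOddAnchors_iff {G : SimpleGraph (Fin (m + 1))} {j : ℕ} :
    HasNumOddAnchors G j ↔
      ∃ l ∈ canonicalWords m, Constructs l G ∧ oddAnchorCount false l = j := by
  constructor
  · rintro ⟨⟨c, rfl, hc⟩, h⟩
    obtain ⟨l, hl, hG, hodd⟩ := exists_canonicalWord c
    exact ⟨l, hl, hG, by rw [← hodd hc, h c rfl hc]⟩
  · rintro ⟨l, hl, hG, rfl⟩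
    exact hasNumOddAnchors_of_constructs hl hG

theorem ncard_hasNumOddAnchors (m j : ℕ) :
    {G : SimpleGraph (Fin (m + 1)) | HasNumOddAnchors G j}.ncard =
      ((canonicalWords m).filter fun l => oddAnchorCount false l = j).card := by
  have hG : ∀ l ∈ canonicalWords m, ∃ G : SimpleGraph (Fin (m + 1)), Constructs l G := by
    intro l hl
    obtain ⟨c, rfl, -⟩ := exists_isCanonical_word_eq hl
    exact ⟨c.graph, (c.constructs_word_iff _).2 rfl⟩
  choose! g hg using hG
  rw [← Set.ncard_coe_finset, ← Set.InjOn.ncard_image (f := g)]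
  · congr 1
    ext G
    simp only [Set.mem_ofPred_eq, hasNumOddAnchors_iff, Set.mem_image, Finset.coe_filter]
    constructor
    · rintro ⟨l, hl, h, hj⟩
      refine ⟨l, ⟨hl, hj⟩, ?_⟩
      have h' := hg l hl
      obtain ⟨c, rfl, -⟩ := exists_isCanonical_word_eq hl
      rw [constructs_word_iff] at h h'
      rw [← h, ← h']
    · rintro ⟨l, ⟨hl, hj⟩, rfl⟩
      exact ⟨l, hl, hg l hl, hj⟩
  · intro l hl l' hl' h
    rw [Finset.mem_coe, Finset.mem_filter] at hl hl'
    exact eq_of_constructs hl.1 hl'.1 (hg l hl.1) (h ▸ hg l' hl'.1)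

theorem sum_canonicalWords (m : ℕ) (t : ℚ) :
    ∑ l ∈ canonicalWords m, t ^ oddAnchorCount false l =
      oddAnchorSum t (m + 1) - (m + 1 : ℕ) * oddAnchorSum t m := by
  have := sum_isConventionalWord_pow_oddAnchorCount t (V := (Finset.univ : Finset (Fin (m + 1))))
    (o := 0) (Finset.mem_univ _) fun x _ => Fin.zero_le x
  rw [Finset.card_univ, Fintype.card_fin] at this
  exact this

theorem hasNumOddAnchors_zero_iff (G : SimpleGraph (Fin 0)) (j : ℕ) :
    HasNumOddAnchors G j ↔ j = 0 := by
  have hnum : ∀ c : ThresholdConstruction 0, c.numOddAnchors = 0 := by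
    intro c
    rw [numOddAnchors_eq, word, List.ofFn_zero, oddAnchorCount]
  have hgraph : ∀ c : ThresholdConstruction 0, c.graph = G := fun c => Subsingleton.elim _ _
  constructor
  · rintro ⟨⟨c, hG, hc⟩, h⟩
    rw [← h c hG hc, hnum]
  · rintro rfl
    exact ⟨⟨⟨Equiv.refl _, fun _ => true⟩, hgraph _, fun p => p.elim0⟩, fun c _ _ => hnum c⟩

end CanonicalWords

theorem theorem5 (n : ℕ) :
    (∀ G : SimpleGraph (Fin n), IsLabeledThresholdGraph G → ∃ k : ℕ, HasNumOddAnchors G k) ∧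
      ∀ j : ℕ, |(characteristicPolynomial (thresholdArrangement n)).coeff j| =
        ({G : SimpleGraph (Fin n) | HasNumOddAnchors G j}.ncard : ℤ) := by
  rcases n with _ | m
  · refine ⟨fun G _ => ⟨0, (hasNumOddAnchors_zero_iff G 0).2 rfl⟩, fun j => ?_⟩
    -- For `n = 0` there is no least label; a single object with statistic `0` stands for the empty
    -- graph.
    rw [abs_coeff_characteristicPolynomial 0 (Finset.univ : Finset Unit) (fun _ => 0)
      (fun t => by simp [oddAnchorSum])]
    simp only [hasNumOddAnchors_zero_iff]
    rcases j with _ | j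
    · simp [Set.ncard_univ]
    · simp
  · constructor
    · rintro _ ⟨c, rfl⟩
      obtain ⟨l, hl, h, -⟩ := exists_canonicalWord c
      exact ⟨_, hasNumOddAnchors_of_constructs hl h⟩
    · intro j
      rw [ncard_hasNumOddAnchors]
      exact abs_coeff_characteristicPolynomial (m + 1) _ _ (sum_canonicalWords m) j
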